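/- Let $m\ge 1$ be an integer and $\lambda\in\mathbb T$ (the unit circle). Let $\mathcal D_\lambda^m=\{f=p+(z-\lambda)^mh:\ p \text{ a polynomial of degree}<m,\ h\in H^2\}$ be the local Dirichlet space of order $m$ at $\lambda$, with norm $\|f\|^2=\|f\|_{H^2}^2+\|h\|_{H^2}^2$, and let $T=M_z$ be multiplication by $z$ on it. Put $\Delta^{(0)}=I$ and $\Delta^{(i)}=T^*\Delta^{(i-1)}T-\Delta^{(i-1)}$. For a distribution $\mu$ on $\mathbb T$ write $\hat\mu(k)=\mu(\bar\zeta^k)$ $(k\in\mathbb Z)$ and let $P_\mu(z)=\sum_{k\ge0}\hat\mu(k)z^k+\sum_{k\ge1}\hat\mu(-k)\bar z^k$ be its Poisson extension to the open unit disc $\mathbb D$; let $D$ be the operator on distributions with $\widehat{D\mu}(k)=|k|\hat\mu(k)$. The order of $\mu$ is the least $N\in\mathbb Z_{\ge0}$ with $|\hat\mu(k)|\le C(1+|k|)^N$ for all $k$ and some constant $C$. Let $\mathcal D_a$ be the space of $C^\infty$ functions $f$ on $\mathbb T$ with $\hat f(k)=0$ for $k<0$, each identified with its analytic extension $\sum_{k\ge0}\hat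 f(k)z^k$ to $\mathbb D$. For a distribution $\mu$ and $f\in\mathcal D_a$ put $$D_{\mu,0}(f)=\lim_{r\to1^-}\int_{\mathbb T}|f(rz)|^2P_\mu(rz)\frac{|dz|}{2\pi},\qquad D_{\mu,i}(f)=\lim_{r\to1^-}\frac1{\pi\, i!\,(i-1)!}\int_{r\mathbb D}|f^{(i)}(z)|^2P_\mu(z)(1-|z|^2)^{i-1}\,dA(z)\quad(i\ge1),$$ and for a tuple $\vec\mu=(\mu_0,\dots,\mu_{n-1})$ put $\|f\|_{\vec\mu}^2=\sum_{i=0}^{n-1}D_{\mu_i,i}(f)$. The tuple is called normalized allowable if $\|1\|_{\vec\mu}^2=1$ and there is $C>0$ with $0\le\|zf\|_{\vec\mu}^2\le C\|f\|_{\vec\mu}^2$ for all $f\in\mathcal D_a$; then $\mathcal D_{\vec\mu}$ denotes the completion of $\mathcal D_a$, modulo functions of norm $0$, with respect to $\|\cdot\|_{\vec\mu}$. Then $T$ is a bounded operator on $\mathcal D_\lambda^m$ which is expansive ($\|Tf\|\ge\|f\|$) and a strict $2m$-isometry ($\Delta^{(2m)}=0\ne\Delta^{(2m-1)}$), and the constant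 function $1$ is a cyclic unit vector for $T$. There is exactly one $2m$-tuple of distributions $\vec\mu=(\mu_0,\dots,\mu_{2m-1})$ on $\mathbb T$ with $$\hat\mu_i(k)=\overline{\hat\mu_i(-k)}=\langle\Delta^{(i)}1,T^k1\rangle_{\mathcal D_\lambda^m}\qquad(k\ge0,\ 0\le i\le 2m-1).$$ This tuple is normalized allowable, and $\mathcal D_{\vec\mu}=\mathcal D_\lambda^m$: the space $\mathcal D_a$ is contained in $\mathcal D_\lambda^m$ as a dense subspace, and $\|f\|_{\vec\mu}=\|f\|_{\mathcal D_\lambda^m}$ for $f\in\mathcal D_a$. It is given by $\mu_0=\frac{|dz|}{2\pi}$, $$\mu_i=\binom{i-1}{m-1}\frac{\prod_{j=i+1-m}^{m-1}(D+j)}{(2m-1-i)!}\,\delta_\lambda\qquad(1\le i\le 2m-2),\qquad \mu_{2m-1}=\binom{2m-2}{m-1}\delta_\lambda ,$$ where $\binom{n}{j}=0$ for $j>n$. In particular $\mu_i=0$ for $1\le i\le m-1$, and $\mu_i$ has order $2m-1-i$ for $m\le i\le 2m-1$. -/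

import Mathlib

open scoped ComplexConjugate Topology ContDiff Nat

noncomputable section

namespace HigherDirichlet

/-! ### The Hardy space and the higher order local Dirichlet spaces -/

/-- The Hardy space `H²` of the disc: square-summable sequences of Taylor coefficients, the
sequence `f` standing for the analytic function `z ↦ ∑ fₙ zⁿ` on the open unit disc. -/
abbrev H2 : Type := lp (fun _ : ℕ => ℂ) 2

/-- The value of `f ∈ H²` at the point `z` (meaningful for `|z| < 1`). -/
def H2.eval (f : H2) (z : ℂ) : ℂ := ∑' n : ℕ, f n * z ^ n

/-- The Szegő kernel at `z`, used to see that point evaluations are continuous. -/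
def H2.kernel (z : ℂ) (hz : ‖z‖ < 1) : H2 :=
  ⟨fun n => conj z ^ n, by
    apply memℓp_gen
    have h : Summable fun n : ℕ => (‖z‖ ^ 2) ^ n :=
      summable_geometric_of_lt_one (by positivity) (by nlinarith [norm_nonneg z])
    refine h.congr fun n => ?_
    simp [← pow_mul, mul_comm]⟩

theorem H2.eval_eq_inner (f : H2) (z : ℂ) (hz : ‖z‖ < 1) :
    f.eval z = inner ℂ (H2.kernel z hz) f := by
  rw [lp.inner_eq_tsum, H2.eval]
  refine tsum_congr fun n => ?_
  simp [H2.kernel]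

theorem H2.eval_add (f g : H2) (z : ℂ) (hz : ‖z‖ < 1) :
    (f + g).eval z = f.eval z + g.eval z := by
  simp only [H2.eval_eq_inner _ z hz, inner_add_right]

theorem H2.eval_smul (c : ℂ) (f : H2) (z : ℂ) (hz : ‖z‖ < 1) :
    (c • f).eval z = c * f.eval z := by
  simp only [H2.eval_eq_inner _ z hz, inner_smul_right]

theorem H2.eval_zero (z : ℂ) (hz : ‖z‖ < 1) : (0 : H2).eval z = 0 := by
  simp only [H2.eval_eq_inner _ z hz, inner_zero_right]

theorem H2.continuous_eval (z : ℂ) (hz : ‖z‖ < 1) : Continuous fun f : H2 => f.eval z := by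
  simp only [H2.eval_eq_inner _ z hz]
  fun_prop

theorem H2.norm_eval_sq_le (f : H2) (z : ℂ) (hz : ‖z‖ < 1) :
    ‖f.eval z‖ ^ 2 * (1 - ‖z‖ ^ 2) ≤ ‖f‖ ^ 2 := by
  have h1 : ‖H2.kernel z hz‖ ^ 2 = (1 - ‖z‖ ^ 2)⁻¹ := by
    have h := lp.norm_rpow_eq_tsum (p := 2) (by norm_num) (H2.kernel z hz)
    have h2 : (2 : ENNReal).toReal = ((2 : ℕ) : ℝ) := by norm_num
    rw [h2, Real.rpow_natCast] at h
    rw [h, ← tsum_geometric_of_lt_one (by positivity) (by nlinarith [norm_nonneg z])]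
    refine tsum_congr fun n => ?_
    rw [Real.rpow_natCast]
    simp [H2.kernel, ← pow_mul, mul_comm]
  have h2 : 0 < 1 - ‖z‖ ^ 2 := by nlinarith [norm_nonneg z]
  have h3 : ‖f.eval z‖ ≤ ‖H2.kernel z hz‖ * ‖f‖ := by
    rw [H2.eval_eq_inner f z hz]; exact norm_inner_le_norm _ _
  calc ‖f.eval z‖ ^ 2 * (1 - ‖z‖ ^ 2)
      ≤ (‖H2.kernel z hz‖ * ‖f‖) ^ 2 * (1 - ‖z‖ ^ 2) := by gcongr
    _ = ‖f‖ ^ 2 := by rw [mul_pow, h1]; field_simp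

theorem H2.hasSum_eval (f : H2) (z : ℂ) (hz : ‖z‖ < 1) :
    HasSum (fun n : ℕ => f n * z ^ n) (f.eval z) := by
  refine Summable.hasSum ((lp.summable_inner (𝕜 := ℂ) (H2.kernel z hz) f).congr fun n => ?_)
  simp [H2.kernel]

theorem H2.eq_zero_of_eval (f : H2) (h : ∀ z : ℂ, ‖z‖ < 1 → f.eval z = 0) : f = 0 := by
  have h1 : HasFPowerSeriesAt (fun _ : ℂ => (0 : ℂ))
      (FormalMultilinearSeries.ofScalars ℂ fun n => f n) 0 := by
    rw [hasFPowerSeriesAt_iff]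
    filter_upwards [Metric.ball_mem_nhds (0 : ℂ) one_pos] with z hz
    have hz' : ‖z‖ < 1 := by simpa using hz
    have := H2.hasSum_eval f z hz'
    rw [h z hz'] at this
    simpa [FormalMultilinearSeries.coeff_ofScalars, mul_comm] using this
  have h2 := h1.eq_zero
  ext n
  have h3 := congrArg (fun p => FormalMultilinearSeries.coeff p n) h2
  rw [FormalMultilinearSeries.coeff_ofScalars] at h3
  rw [h3]
  simp [FormalMultilinearSeries.coeff]

/-- Multiplication by `z` on `H²`. -/
def H2.mulZ (f : H2) : H2 :=
  ⟨fun n => n.casesOn 0 fun k => f k, by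
    apply memℓp_gen
    have h := (lp.memℓp f).summable (by norm_num)
    rw [← summable_nat_add_iff 1]
    exact h⟩

theorem H2.eval_mulZ (f : H2) (z : ℂ) (hz : ‖z‖ < 1) : (H2.mulZ f).eval z = z * f.eval z := by
  have h := H2.hasSum_eval (H2.mulZ f) z hz
  rw [← hasSum_nat_add_iff' 1] at h
  have h2 := (H2.hasSum_eval f z hz).mul_left z
  have h3 := h.unique (by
    refine h2.congr_fun fun n => ?_
    simp only [H2.mulZ]
    ring)
  simpa [H2.mulZ] using h3

/-- The constant function `c`. -/
def H2.const (c : ℂ) : H2 := lp.single 2 0 c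

theorem H2.eval_const (c z : ℂ) : (H2.const c).eval z = c := by
  rw [H2.eval, tsum_eq_single 0]
  · simp [H2.const]
  · intro n hn
    simp [H2.const, hn]

/-- The local Dirichlet space `D_λ^m` of order `m` at `λ ∈ 𝕋`: all
`f = p + (z - λ)^m h` with `p` a polynomial of degree `< m` and `h ∈ H²`, with the norm
`‖f‖² = ‖f‖²_{H²} + ‖h‖²_{H²}`. The element `f` is stored together with `h` as the pair
`(f, h)` in the Hilbert sum `H² ⊕ H²`, whose norm induces exactly the required one;
`h` is determined by `f`, see `LocalDirichlet.eval_injective`. -/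
def LocalDirichlet (m : ℕ) (lam : Circle) : Submodule ℂ (WithLp 2 (H2 × H2)) where
  carrier := {F | ∃ p : Polynomial ℂ, p ∈ Polynomial.degreeLT ℂ m ∧
    ∀ z : ℂ, ‖z‖ < 1 → F.fst.eval z = p.eval z + (z - lam) ^ m * F.snd.eval z}
  add_mem' := by
    rintro F G ⟨p, hp, hF⟩ ⟨q, hq, hG⟩
    refine ⟨p + q, Submodule.add_mem _ hp hq, fun z hz => ?_⟩
    simp only [WithLp.add_fst, WithLp.add_snd, H2.eval_add _ _ z hz, hF z hz, hG z hz,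
      Polynomial.eval_add]
    ring
  zero_mem' := ⟨0, Submodule.zero_mem _, fun z hz => by simp [H2.eval_zero z hz]⟩
  smul_mem' := by
    rintro c F ⟨p, hp, hF⟩
    refine ⟨c • p, Submodule.smul_mem _ c hp, fun z hz => ?_⟩
    simp only [WithLp.smul_fst, WithLp.smul_snd, H2.eval_smul _ _ z hz, hF z hz,
      Polynomial.eval_smul, smul_eq_mul]
    ring

namespace LocalDirichlet

variable {m : ℕ} {lam : Circle}

/-- The value at `z`, `|z| < 1`, of an element of `D_λ^m` as an analytic function. -/
def eval (F : LocalDirichlet m lam) (z : ℂ) : ℂ := (F : WithLp 2 (H2 × H2)).fst.eval z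

theorem eval_add (F G : LocalDirichlet m lam) (z : ℂ) (hz : ‖z‖ < 1) :
    eval (F + G) z = eval F z + eval G z := H2.eval_add _ _ z hz

theorem eval_smul (c : ℂ) (F : LocalDirichlet m lam) (z : ℂ) (hz : ‖z‖ < 1) :
    eval (c • F) z = c * eval F z := H2.eval_smul _ _ z hz

theorem continuous_eval (z : ℂ) (hz : ‖z‖ < 1) :
    Continuous fun F : LocalDirichlet m lam => eval F z :=
  (H2.continuous_eval z hz).comp
    ((WithLp.continuous_fst 2 H2 H2).comp continuous_subtype_val)

theorem sub_ne_zero_of_norm_lt {z : ℂ} (hz : ‖z‖ < 1) (lam : Circle) : z - lam ≠ 0 := by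
  intro h
  rw [sub_eq_zero] at h
  rw [h, Circle.norm_coe] at hz
  exact lt_irrefl _ hz

theorem poly_eq_zero (p : Polynomial ℂ) (hp : p ∈ Polynomial.degreeLT ℂ m) (h : H2)
    (hh : ∀ z : ℂ, ‖z‖ < 1 → p.eval z + (z - lam) ^ m * h.eval z = 0) : p = 0 := by
  by_contra hp0
  obtain ⟨q, hq, hqd⟩ := Polynomial.exists_eq_pow_rootMultiplicity_mul_and_not_dvd p hp0 (lam : ℂ)
  set s := p.rootMultiplicity (lam : ℂ)
  have hs : s < m := by
    rw [Polynomial.mem_degreeLT] at hp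
    have h1 : p.natDegree < m := (Polynomial.natDegree_lt_iff_degree_lt hp0).2 hp
    have h2 := Polynomial.natDegree_le_of_dvd (Dvd.intro _ hq.symm) hp0
    rw [(Polynomial.monic_X_sub_C (lam : ℂ)).natDegree_pow, Polynomial.natDegree_X_sub_C,
      mul_one] at h2
    exact lt_of_le_of_lt h2 h1
  have hqn : q.eval (lam : ℂ) ≠ 0 := fun h0 => hqd (Polynomial.dvd_iff_isRoot.2 h0)
  obtain ⟨t, rfl⟩ : ∃ t, m = s + (t + 1) := ⟨m - s - 1, by omega⟩
  have key : ∀ r : ℝ, 0 < r → r < 1 →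
      ‖q.eval ((r : ℂ) * lam)‖ ^ 2 * (1 + r) ≤ (1 - r) * ‖h‖ ^ 2 := by
    intro r hr0 hr1
    have hz : ‖(r : ℂ) * lam‖ < 1 := by simpa [abs_of_pos hr0, Circle.norm_coe] using hr1
    have hn : ‖(r : ℂ) * lam‖ = r := by simp [abs_of_pos hr0, Circle.norm_coe]
    have h0 := hh _ hz
    have hne := sub_ne_zero_of_norm_lt hz lam
    have hd : ‖(r : ℂ) * lam - lam‖ = 1 - r := by
      have : (r : ℂ) * lam - lam = ((r - 1 : ℝ) : ℂ) * lam := by push_cast; ring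
      rw [this, norm_mul, Circle.norm_coe, mul_one, Complex.norm_real, Real.norm_eq_abs,
        abs_of_neg (by linarith)]
      ring
    rw [hq] at h0
    simp only [Polynomial.eval_mul, Polynomial.eval_pow, Polynomial.eval_sub, Polynomial.eval_X,
      Polynomial.eval_C] at h0
    have h1 : q.eval ((r : ℂ) * lam) = -(((r : ℂ) * lam - lam) ^ (t + 1) * h.eval (r * lam)) := by
      apply mul_left_cancel₀ (pow_ne_zero s hne)
      rw [pow_add] at h0
      linear_combination h0
    have h2 := H2.norm_eval_sq_le h _ hz
    rw [hn] at h2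
    rw [h1, norm_neg, norm_mul, norm_pow, hd]
    have h3 : (1 - r) ^ (t + 1) ≤ 1 - r := by
      rw [pow_succ]
      exact mul_le_of_le_one_left (by linarith) (pow_le_one₀ (by linarith) (by linarith))
    have h4 : 0 ≤ (1 - r) ^ (t + 1) := pow_nonneg (by linarith) _
    calc ((1 - r) ^ (t + 1) * ‖h.eval (r * lam)‖) ^ 2 * (1 + r)
        ≤ ((1 - r) * ‖h.eval (r * lam)‖) ^ 2 * (1 + r) := by gcongr
      _ = (1 - r) * (‖h.eval (r * lam)‖ ^ 2 * (1 - r ^ 2)) := by ring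
      _ ≤ (1 - r) * ‖h‖ ^ 2 := by
          apply mul_le_mul_of_nonneg_left h2; linarith
  have hl : Filter.Tendsto (fun r : ℝ => ‖q.eval ((r : ℂ) * lam)‖ ^ 2 * (1 + r)) (𝓝[<] 1)
      (𝓝 (‖q.eval (((1 : ℝ) : ℂ) * lam)‖ ^ 2 * (1 + 1))) := by
    apply Filter.Tendsto.mono_left _ nhdsWithin_le_nhds
    apply Continuous.tendsto
    have := q.continuous
    fun_prop
  have hr : Filter.Tendsto (fun r : ℝ => (1 - r) * ‖h‖ ^ 2) (𝓝[<] 1)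
      (𝓝 ((1 - 1) * ‖h‖ ^ 2)) := by
    apply Filter.Tendsto.mono_left _ nhdsWithin_le_nhds
    apply Continuous.tendsto
    fun_prop
  have hle := le_of_tendsto_of_tendsto hl hr (by
    filter_upwards [Ioo_mem_nhdsLT (zero_lt_one' ℝ)] with r hr
    exact key r hr.1 hr.2)
  have hpos : 0 < ‖q.eval (lam : ℂ)‖ := norm_pos_iff.2 hqn
  simp only [Complex.ofReal_one, one_mul] at hle
  nlinarith

/-- An element of `D_λ^m` is determined by its values on the disc. -/
theorem eval_injective (F G : LocalDirichlet m lam)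
    (h : ∀ z : ℂ, ‖z‖ < 1 → eval F z = eval G z) : F = G := by
  rw [← sub_eq_zero]
  have hE : ∀ z : ℂ, ‖z‖ < 1 → eval (F - G) z = 0 := fun z hz => by
    have h1 := eval_add (F - G) G z hz
    rw [sub_add_cancel, h z hz] at h1
    linear_combination -h1
  obtain ⟨p, hp, hF⟩ := (F - G).2
  have hp0 : p = 0 := poly_eq_zero (lam := lam) p hp _ fun z hz => by
    rw [← hF z hz]; exact hE z hz
  have h1 : ((F - G : LocalDirichlet m lam) : WithLp 2 (H2 × H2)).fst = 0 :=
    H2.eq_zero_of_eval _ hE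
  have h2 : ((F - G : LocalDirichlet m lam) : WithLp 2 (H2 × H2)).snd = 0 := by
    refine H2.eq_zero_of_eval _ fun z hz => ?_
    have h3 := hF z hz
    rw [h1, H2.eval_zero z hz, hp0, Polynomial.eval_zero, zero_add] at h3
    exact (mul_eq_zero.1 h3.symm).resolve_left
      (pow_ne_zero _ (sub_ne_zero_of_norm_lt hz lam))
  apply Subtype.ext
  apply (WithLp.equiv 2 (H2 × H2)).injective
  exact Prod.ext h1 h2

theorem isClosed (m : ℕ) (lam : Circle) :
    IsClosed (LocalDirichlet m lam : Set (WithLp 2 (H2 × H2))) := by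
  let L : Polynomial ℂ →ₗ[ℂ] (Metric.ball (0 : ℂ) 1 → ℂ) :=
    { toFun := fun p z => p.eval (z : ℂ)
      map_add' := fun p q => by ext z; simp
      map_smul' := fun c p => by ext z; simp }
  let V : Submodule ℂ (Metric.ball (0 : ℂ) 1 → ℂ) := (Polynomial.degreeLT ℂ m).map L
  have : FiniteDimensional ℂ (Polynomial.degreeLT ℂ m) :=
    (Polynomial.degreeLTEquiv ℂ m).symm.finiteDimensional
  have hV : IsClosed (V : Set (Metric.ball (0 : ℂ) 1 → ℂ)) := V.closed_of_finiteDimensional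
  let Φ : WithLp 2 (H2 × H2) → (Metric.ball (0 : ℂ) 1 → ℂ) :=
    fun F z => F.fst.eval z - ((z : ℂ) - lam) ^ m * F.snd.eval z
  have hΦ : Continuous Φ := by
    refine continuous_pi fun z => ?_
    have hz : ‖(z : ℂ)‖ < 1 := mem_ball_zero_iff.1 z.2
    have h1 := (H2.continuous_eval z hz).comp (WithLp.continuous_fst 2 H2 H2)
    have h2 := (H2.continuous_eval z hz).comp (WithLp.continuous_snd 2 H2 H2)
    exact h1.sub (continuous_const.mul h2)
  convert hV.preimage hΦ using 1
  ext F
  constructor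
  · rintro ⟨p, hp, hF⟩
    refine ⟨p, hp, ?_⟩
    ext z
    have hz : ‖(z : ℂ)‖ < 1 := mem_ball_zero_iff.1 z.2
    simp [L, Φ, hF z hz]
  · rintro ⟨p, hp, hF⟩
    refine ⟨p, hp, fun z hz => ?_⟩
    have h1 := congrFun hF ⟨z, by simpa using hz⟩
    simp only [L, Φ, LinearMap.coe_mk, AddHom.coe_mk] at h1
    rw [h1]; ring

instance : CompleteSpace (LocalDirichlet m lam) :=
  (isClosed m lam).completeSpace_coe

theorem exists_shift (F : LocalDirichlet m lam) :
    ∃ G : LocalDirichlet m lam, ∀ z : ℂ, ‖z‖ < 1 → eval G z = z * eval F z := by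
  obtain ⟨⟨f, h⟩, p, hp, hF⟩ := F
  rw [Polynomial.mem_degreeLT, Polynomial.degree_lt_iff_coeff_zero] at hp
  set c := p.coeff (m - 1)
  have hq : Polynomial.X * p - Polynomial.C c * (Polynomial.X - Polynomial.C (lam : ℂ)) ^ m ∈
      Polynomial.degreeLT ℂ m := by
    rw [Polynomial.mem_degreeLT, Polynomial.degree_lt_iff_coeff_zero]
    intro n hn
    have hmon : ((Polynomial.X - Polynomial.C (lam : ℂ)) ^ m).Monic :=
      (Polynomial.monic_X_sub_C _).pow m
    have hdeg : ((Polynomial.X - Polynomial.C (lam : ℂ)) ^ m).natDegree = m := by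
      simp [(Polynomial.monic_X_sub_C (lam : ℂ)).natDegree_pow]
    rw [Polynomial.coeff_sub, Polynomial.coeff_C_mul]
    rcases hn.eq_or_lt with rfl | hlt
    · have h1 := hmon.coeff_natDegree
      rw [hdeg] at h1
      rw [h1]
      rcases m with _ | m
      · simp [c, hp 0 le_rfl]
      · simp [c, Polynomial.coeff_X_mul]
    · rw [Polynomial.coeff_eq_zero_of_natDegree_lt
        (p := (Polynomial.X - Polynomial.C (lam : ℂ)) ^ m) (by rw [hdeg]; exact hlt)]
      obtain ⟨n, rfl⟩ : ∃ k, n = k + 1 := ⟨n - 1, by omega⟩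
      rw [Polynomial.coeff_X_mul, hp n (by omega)]
      simp
  refine ⟨⟨WithLp.toLp 2 (H2.mulZ f, H2.mulZ h + H2.const c), _, hq, ?_⟩, ?_⟩
  · intro z hz
    have h1 := hF z hz
    simp only [H2.eval_mulZ _ z hz, H2.eval_add _ _ z hz, H2.eval_const, WithLp.fst, WithLp.snd]
      at h1 ⊢
    rw [h1]
    simp
    ring
  · intro z hz
    exact H2.eval_mulZ _ z hz

theorem one_mem (hm : 1 ≤ m) :
    WithLp.toLp 2 (H2.const 1, (0 : H2)) ∈ LocalDirichlet m lam := by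
  refine ⟨1, ?_, fun z hz => ?_⟩
  · rw [Polynomial.mem_degreeLT]
    exact lt_of_le_of_lt Polynomial.degree_one_le (by exact_mod_cast hm)
  · simp [H2.eval_const, H2.eval_zero z hz]

/-- The constant function `1`, an element of `D_λ^m` for `m ≥ 1`. -/
def one (m : ℕ) (lam : Circle) (hm : 1 ≤ m) : LocalDirichlet m lam :=
  ⟨WithLp.toLp 2 (H2.const 1, (0 : H2)), one_mem hm⟩

end LocalDirichlet

/-- The shift `M_z`, `f ↦ z f`, as a linear map on `D_λ^m`. -/
def shiftLin (m : ℕ) (lam : Circle) : LocalDirichlet m lam →ₗ[ℂ] LocalDirichlet m lam where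
  toFun F := (LocalDirichlet.exists_shift F).choose
  map_add' F G := by
    apply LocalDirichlet.eval_injective
    intro z hz
    rw [LocalDirichlet.eval_add _ _ z hz, (LocalDirichlet.exists_shift (F + G)).choose_spec z hz,
      (LocalDirichlet.exists_shift F).choose_spec z hz,
      (LocalDirichlet.exists_shift G).choose_spec z hz, LocalDirichlet.eval_add _ _ z hz, mul_add]
  map_smul' c F := by
    apply LocalDirichlet.eval_injective
    intro z hz
    rw [RingHom.id_apply, LocalDirichlet.eval_smul _ _ z hz,
      (LocalDirichlet.exists_shift (c • F)).choose_spec z hz,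
      (LocalDirichlet.exists_shift F).choose_spec z hz, LocalDirichlet.eval_smul _ _ z hz]
    ring

theorem eval_shiftLin (m : ℕ) (lam : Circle) (F : LocalDirichlet m lam) (z : ℂ) (hz : ‖z‖ < 1) :
    LocalDirichlet.eval (shiftLin m lam F) z = z * LocalDirichlet.eval F z :=
  (LocalDirichlet.exists_shift F).choose_spec z hz

/-- The shift `M_z` as a bounded operator on `D_λ^m` (bounded by the closed graph theorem). -/
def shift (m : ℕ) (lam : Circle) : LocalDirichlet m lam →L[ℂ] LocalDirichlet m lam where
  toLinearMap := shiftLin m lam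
  cont := by
    apply LinearMap.continuous_of_seq_closed_graph
    intro u F G hu hG
    apply LocalDirichlet.eval_injective
    intro z hz
    have hc := LocalDirichlet.continuous_eval (m := m) (lam := lam) z hz
    have h1 := (hc.tendsto G).comp hG
    have h2 := ((hc.tendsto F).comp hu).const_mul z
    rw [eval_shiftLin m lam F z hz]
    refine tendsto_nhds_unique h1 (h2.congr fun n => ?_)
    simp only [Function.comp]
    rw [eval_shiftLin m lam _ z hz]

/-- `M_z` is multiplication by the independent variable. -/
theorem eval_shift (m : ℕ) (lam : Circle) (F : LocalDirichlet m lam) (z : ℂ) (hz : ‖z‖ < 1) :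
    LocalDirichlet.eval (shift m lam F) z = z * LocalDirichlet.eval F z :=
  eval_shiftLin m lam F z hz

/-! ### Test functions and distributions on the unit circle -/

/-- The space of `C^∞` functions on the unit circle. -/
def testSubmodule : Submodule ℂ (Circle → ℂ) where
  carrier := {f | ContDiff ℝ ∞ fun t : ℝ => f (Circle.exp t)}
  add_mem' := fun {f g} (hf : ContDiff ℝ ∞ fun t : ℝ => f (Circle.exp t))
    (hg : ContDiff ℝ ∞ fun t : ℝ => g (Circle.exp t)) => hf.add hg
  zero_mem' := show ContDiff ℝ ∞ fun _ : ℝ => (0 : ℂ) from contDiff_const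
  smul_mem' := fun c f (hf : ContDiff ℝ ∞ fun t : ℝ => f (Circle.exp t)) => hf.const_smul c

/-- The type of `C^∞` functions on the unit circle. -/
abbrev TestFun : Type := testSubmodule

/-- The `2π`-periodic function `t ↦ f (e^{it})`. -/
def TestFun.lift (f : TestFun) : ℝ → ℂ := fun t => (f : Circle → ℂ) (Circle.exp t)

theorem TestFun.contDiff_lift (f : TestFun) : ContDiff ℝ ∞ f.lift := f.2

theorem TestFun.lift_periodic (f : TestFun) : Function.Periodic f.lift (2 * Real.pi) := by
  intro t
  simp [TestFun.lift]

theorem TestFun.lift_add (f g : TestFun) : TestFun.lift (f + g) = f.lift + g.lift := rfl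

theorem TestFun.lift_smul (c : ℂ) (f : TestFun) : TestFun.lift (c • f) = c • f.lift := rfl

/-- The Fourier coefficient `∫ f(ζ) ζ̄^k |dζ| / 2π` of a test function. -/
def TestFun.coeff (f : TestFun) (k : ℤ) : ℂ :=
  (2 * Real.pi : ℂ)⁻¹ * ∫ t in (0 : ℝ)..2 * Real.pi, f.lift t * ((Circle.exp t ^ (-k) : Circle) : ℂ)

theorem contDiff_exp_zpow (k : ℤ) :
    ContDiff ℝ ∞ fun t : ℝ => ((Circle.exp t ^ k : Circle) : ℂ) := by
  have h : (fun t : ℝ => ((Circle.exp t ^ k : Circle) : ℂ)) =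
      fun t : ℝ => Complex.exp ((k * Complex.I) * (t : ℂ)) := by
    ext t
    rw [Circle.coe_zpow, Circle.coe_exp, ← Complex.exp_int_mul]
    ring_nf
  rw [h]
  exact (contDiff_const.mul Complex.ofRealCLM.contDiff).cexp

/-- The test function `ζ ↦ ζ^k`. -/
def monomial (k : ℤ) : TestFun := ⟨fun ζ => ((ζ ^ k : Circle) : ℂ), contDiff_exp_zpow k⟩

/-- The test function `ζ ↦ ζ f(ζ)`. -/
def TestFun.mulZ (f : TestFun) : TestFun :=
  ⟨fun ζ => (ζ : ℂ) * (f : Circle → ℂ) ζ, by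
    have h := (contDiff_exp_zpow 1).mul f.contDiff_lift
    simp only [zpow_one] at h
    exact h⟩

/-- Distributions on the circle: linear functionals `μ` on the `C^∞` functions that are
continuous, that is, bounded by a multiple of `max_{j ≤ N} sup |f^{(j)}|` for some `N`. -/
def distributionSubmodule : Submodule ℂ (Module.Dual ℂ TestFun) where
  carrier := {μ | ∃ (N : ℕ) (C : ℝ), ∀ (f : TestFun) (M : ℝ),
    (∀ j ≤ N, ∀ t : ℝ, ‖iteratedDeriv j f.lift t‖ ≤ M) → ‖μ f‖ ≤ C * M}
  add_mem' := by
    rintro μ ν ⟨N, C, h⟩ ⟨N', C', h'⟩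
    refine ⟨max N N', C + C', fun f M hM => ?_⟩
    have h1 := h f M fun j hj => hM j (hj.trans (le_max_left _ _))
    have h2 := h' f M fun j hj => hM j (hj.trans (le_max_right _ _))
    rw [LinearMap.add_apply, add_mul]
    exact (norm_add_le _ _).trans (add_le_add h1 h2)
  zero_mem' := ⟨0, 0, fun f M _ => by simp⟩
  smul_mem' := by
    rintro c μ ⟨N, C, h⟩
    refine ⟨N, ‖c‖ * C, fun f M hM => ?_⟩
    rw [LinearMap.smul_apply, norm_smul, mul_assoc]
    exact mul_le_mul_of_nonneg_left (h f M hM) (norm_nonneg c)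

/-- The type of distributions on the unit circle. -/
abbrev Distribution : Type := distributionSubmodule

/-- The Fourier coefficient `μ(ζ̄^k)` of a distribution. -/
def Distribution.coeff (μ : Distribution) (k : ℤ) : ℂ :=
  (μ : Module.Dual ℂ TestFun) (monomial (-k))

/-- The Dirac measure at `λ`. -/
def dirac (lam : Circle) : Distribution :=
  ⟨{ toFun := fun f => (f : Circle → ℂ) lam
     map_add' := fun _ _ => rfl
     map_smul' := fun _ _ => rfl }, ⟨0, 1, fun f M hM => by
      have h := hM 0 le_rfl (Complex.arg lam)
      rw [one_mul]
      simpa [TestFun.lift] using h⟩⟩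

theorem TestFun.intervalIntegrable (f : TestFun) (k : ℤ) :
    IntervalIntegrable (fun t : ℝ => f.lift t * ((Circle.exp t ^ (-k) : Circle) : ℂ))
      MeasureTheory.volume 0 (2 * Real.pi) :=
  (f.contDiff_lift.continuous.mul (contDiff_exp_zpow (-k)).continuous).intervalIntegrable _ _

theorem TestFun.coeff_add (f g : TestFun) (k : ℤ) :
    TestFun.coeff (f + g) k = f.coeff k + g.coeff k := by
  simp only [TestFun.coeff, TestFun.lift_add, Pi.add_apply, add_mul]
  rw [intervalIntegral.integral_add (f.intervalIntegrable k) (g.intervalIntegrable k), mul_add]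

theorem TestFun.coeff_smul (c : ℂ) (f : TestFun) (k : ℤ) :
    TestFun.coeff (c • f) k = c * f.coeff k := by
  simp only [TestFun.coeff, TestFun.lift_smul, Pi.smul_apply, smul_eq_mul, mul_assoc]
  rw [intervalIntegral.integral_const_mul]
  ring

theorem TestFun.coeff_mulZ (f : TestFun) (k : ℤ) :
    TestFun.coeff f.mulZ k = f.coeff (k - 1) := by
  rw [TestFun.coeff, TestFun.coeff]
  congr 1
  refine intervalIntegral.integral_congr fun t _ => ?_
  have h : Circle.exp t ^ (-(k - 1)) = Circle.exp t * Circle.exp t ^ (-k) := by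
    rw [← zpow_one_add]; congr 1; ring
  simp only [TestFun.lift, TestFun.mulZ, h, Circle.coe_mul]
  ring

theorem norm_integral_le {g : ℝ → ℂ} {M : ℝ} (hM : ∀ t, ‖g t‖ ≤ M) (k : ℤ) :
    ‖(2 * Real.pi : ℂ)⁻¹ * ∫ t in (0 : ℝ)..2 * Real.pi,
      g t * ((Circle.exp t ^ (-k) : Circle) : ℂ)‖ ≤ M := by
  have h := intervalIntegral.norm_integral_le_of_norm_le_const (a := 0) (b := 2 * Real.pi)
    (f := fun t => g t * ((Circle.exp t ^ (-k) : Circle) : ℂ)) (C := M) (fun t _ => by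
      rw [norm_mul, Circle.norm_coe, mul_one]; exact hM t)
  have hpi := Real.pi_pos
  have h2 : ‖(2 * Real.pi : ℂ)⁻¹‖ = (2 * Real.pi)⁻¹ := by
    simp [abs_of_pos hpi]
  rw [norm_mul, h2]
  rw [sub_zero, abs_of_pos (by positivity)] at h
  calc (2 * Real.pi)⁻¹ * _ ≤ (2 * Real.pi)⁻¹ * (M * (2 * Real.pi)) := by gcongr
    _ = M := by field_simp

/-- The Lebesgue measure `|dz| / 2π`, of total mass one. -/
def lebesgue : Distribution :=
  ⟨{ toFun := fun f => f.coeff 0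
     map_add' := fun f g => TestFun.coeff_add f g 0
     map_smul' := fun c f => TestFun.coeff_smul c f 0 }, ⟨0, 1, fun f M hM => by
      rw [one_mul]
      exact norm_integral_le (fun t => by simpa using hM 0 le_rfl t) 0⟩⟩

theorem hasDerivAt_exp_zpow (k : ℤ) (t : ℝ) :
    HasDerivAt (fun t : ℝ => ((Circle.exp t ^ k : Circle) : ℂ))
      (k * Complex.I * ((Circle.exp t ^ k : Circle) : ℂ)) t := by
  have h : (fun t : ℝ => ((Circle.exp t ^ k : Circle) : ℂ)) =
      fun t : ℝ => Complex.exp ((k * Complex.I) * (t : ℂ)) := by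
    ext t
    rw [Circle.coe_zpow, Circle.coe_exp, ← Complex.exp_int_mul]
    ring_nf
  have h2 : HasDerivAt (fun t : ℝ => (k * Complex.I) * (t : ℂ)) (k * Complex.I) t := by
    simpa using (Complex.ofRealCLM.hasDerivAt (x := t)).const_mul (k * Complex.I : ℂ)
  have h3 := h2.cexp
  rw [congrFun h t, h]
  convert h3 using 1
  ring

theorem iteratedDeriv_monomial (k : ℤ) (j : ℕ) :
    iteratedDeriv j (monomial k).lift =
      fun t => (k * Complex.I) ^ j * ((Circle.exp t ^ k : Circle) : ℂ) := by
  induction j with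
  | zero => ext t; simp [TestFun.lift, monomial]
  | succ j ih =>
    rw [iteratedDeriv_succ, ih]
    ext t
    rw [((hasDerivAt_exp_zpow k t).const_mul _).deriv]
    ring

/-- The Fourier coefficients of a distribution have at most polynomial growth. -/
theorem Distribution.growth (μ : Distribution) :
    ∃ (N : ℕ) (C : ℝ), ∀ k : ℤ, ‖μ.coeff k‖ ≤ C * (1 + |(k : ℝ)|) ^ N := by
  obtain ⟨N, C, h⟩ := μ.2
  refine ⟨N, C, fun k => h _ _ fun j hj t => ?_⟩
  rw [iteratedDeriv_monomial]
  have hk : (0 : ℝ) ≤ |(k : ℝ)| := abs_nonneg _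
  simp only [norm_mul, norm_pow, Circle.norm_coe, mul_one, Complex.norm_I, Int.cast_neg, norm_neg,
    Complex.norm_intCast]
  calc |(k : ℝ)| ^ j ≤ (1 + |(k : ℝ)|) ^ j := by gcongr; linarith
    _ ≤ (1 + |(k : ℝ)|) ^ N := pow_le_pow_right₀ (by linarith) hj

theorem integral_deriv_mul {g : ℝ → ℂ} (hg : ContDiff ℝ ∞ g)
    (hp : Function.Periodic g (2 * Real.pi)) (k : ℤ) :
    ∫ t in (0 : ℝ)..2 * Real.pi, deriv g t * ((Circle.exp t ^ (-k) : Circle) : ℂ) =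
      k * Complex.I *
        ∫ t in (0 : ℝ)..2 * Real.pi, g t * ((Circle.exp t ^ (-k) : Circle) : ℂ) := by
  have hd : Continuous (deriv g) := hg.continuous_deriv (by norm_num)
  have he := (contDiff_exp_zpow (-k)).continuous
  have h := intervalIntegral.integral_deriv_mul_eq_sub (a := 0) (b := 2 * Real.pi)
    (u := g) (v := fun t : ℝ => ((Circle.exp t ^ (-k) : Circle) : ℂ)) (u' := deriv g)
    (v' := fun t => ((-k : ℤ) : ℂ) * Complex.I * ((Circle.exp t ^ (-k) : Circle) : ℂ))
    (fun t _ => (hg.differentiable (by norm_num) t).hasDerivAt)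
    (fun t _ => hasDerivAt_exp_zpow (-k) t)
    (hd.intervalIntegrable _ _) ((continuous_const.mul he).intervalIntegrable _ _)
  have hg0 : g (2 * Real.pi) = g 0 := by simpa using hp 0
  have i1 : IntervalIntegrable (fun t => deriv g t * ((Circle.exp t ^ (-k) : Circle) : ℂ))
      MeasureTheory.volume 0 (2 * Real.pi) := (hd.mul he).intervalIntegrable _ _
  have i2 : IntervalIntegrable
      (fun t => g t * (((-k : ℤ) : ℂ) * Complex.I * ((Circle.exp t ^ (-k) : Circle) : ℂ)))
      MeasureTheory.volume 0 (2 * Real.pi) :=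
    (hg.continuous.mul (continuous_const.mul he)).intervalIntegrable _ _
  rw [hg0, intervalIntegral.integral_add i1 i2] at h
  have h2 : ∫ t in (0 : ℝ)..2 * Real.pi,
      g t * (((-k : ℤ) : ℂ) * Complex.I * ((Circle.exp t ^ (-k) : Circle) : ℂ)) =
      -(k * Complex.I *
        ∫ t in (0 : ℝ)..2 * Real.pi, g t * ((Circle.exp t ^ (-k) : Circle) : ℂ)) := by
    rw [← intervalIntegral.integral_const_mul, ← intervalIntegral.integral_neg]
    refine intervalIntegral.integral_congr fun t _ => ?_
    push_cast
    ring
  rw [h2] at h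
  simp only [Circle.exp_two_pi, Circle.exp_zero, one_zpow, sub_self] at h
  linear_combination h

theorem integral_iteratedDeriv_mul (j : ℕ) : ∀ {g : ℝ → ℂ}, ContDiff ℝ ∞ g →
    Function.Periodic g (2 * Real.pi) → ∀ k : ℤ,
    ∫ t in (0 : ℝ)..2 * Real.pi, iteratedDeriv j g t * ((Circle.exp t ^ (-k) : Circle) : ℂ) =
      (k * Complex.I) ^ j *
        ∫ t in (0 : ℝ)..2 * Real.pi, g t * ((Circle.exp t ^ (-k) : Circle) : ℂ) := by
  induction j with
  | zero => intro g _ _ k; simp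
  | succ j ih =>
    intro g hg hp k
    have hd : ContDiff ℝ ∞ (deriv g) := (contDiff_infty_iff_deriv.1 hg).2
    have hdp : Function.Periodic (deriv g) (2 * Real.pi) := fun t => by
      rw [← deriv_comp_add_const, funext hp]
    rw [iteratedDeriv_succ', ih hd hdp k, integral_deriv_mul hg hp k]
    ring

/-- The Fourier coefficients of a test function decay rapidly. -/
theorem TestFun.decay (f : TestFun) (N : ℕ) (M : ℝ)
    (hM : ∀ j ≤ N, ∀ t : ℝ, ‖iteratedDeriv j f.lift t‖ ≤ M) (k : ℤ) :
    ‖f.coeff k‖ * (1 + |(k : ℝ)|) ^ N ≤ 2 ^ N * M := by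
  have h : ∀ j ≤ N, |(k : ℝ)| ^ j * ‖f.coeff k‖ ≤ M := by
    intro j hj
    have h1 := norm_integral_le (hM j hj) k
    rw [integral_iteratedDeriv_mul j f.contDiff_lift f.lift_periodic k, mul_left_comm,
      norm_mul] at h1
    simpa [TestFun.coeff, Complex.norm_intCast] using h1
  have hk : (0 : ℝ) ≤ |(k : ℝ)| := abs_nonneg _
  have hn := norm_nonneg (f.coeff k)
  rcases le_total |(k : ℝ)| 1 with h1 | h1
  · calc ‖f.coeff k‖ * (1 + |(k : ℝ)|) ^ N ≤ ‖f.coeff k‖ * 2 ^ N := by gcongr; linarith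
      _ ≤ 2 ^ N * M := by
        rw [mul_comm]; gcongr; simpa using h 0 (Nat.zero_le _)
  · calc ‖f.coeff k‖ * (1 + |(k : ℝ)|) ^ N ≤ ‖f.coeff k‖ * (2 * |(k : ℝ)|) ^ N := by
          gcongr; linarith
      _ = 2 ^ N * (|(k : ℝ)| ^ N * ‖f.coeff k‖) := by rw [mul_pow]; ring
      _ ≤ 2 ^ N * M := by gcongr; exact h N le_rfl

theorem TestFun.exists_bound (f : TestFun) (N : ℕ) :
    ∃ M : ℝ, ∀ j ≤ N, ∀ t : ℝ, ‖iteratedDeriv j f.lift t‖ ≤ M := by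
  have hper : ∀ j : ℕ, Function.Periodic (iteratedDeriv j f.lift) (2 * Real.pi) := by
    intro j
    induction j with
    | zero => simpa using f.lift_periodic
    | succ j ih =>
      intro t
      rw [iteratedDeriv_succ, ← deriv_comp_add_const, funext ih]
  have h1 : ∀ j : ℕ, ∃ M : ℝ, ∀ t : ℝ, ‖iteratedDeriv j f.lift t‖ ≤ M := by
    intro j
    have hc : Continuous (iteratedDeriv j f.lift) :=
      f.contDiff_lift.continuous_iteratedDeriv j (by exact_mod_cast le_top)
    obtain ⟨M, hM⟩ := (isCompact_Icc (a := (0 : ℝ)) (b := 2 * Real.pi)).exists_bound_of_continuousOn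
      hc.continuousOn
    refine ⟨M, fun t => ?_⟩
    obtain ⟨s, hs, hst⟩ := (hper j).exists_mem_Ico₀ (by positivity) t
    rw [hst]
    exact hM s (Set.Ico_subset_Icc_self hs)
  choose M hM using h1
  refine ⟨∑ i ∈ Finset.range (N + 1), |M i|, fun j hj t => ?_⟩
  calc _ ≤ M j := hM j t
    _ ≤ |M j| := le_abs_self _
    _ ≤ _ := Finset.single_le_sum (f := fun i => |M i|) (fun _ _ => abs_nonneg _)
      (Finset.mem_range.2 (by omega))

theorem summable_inv_sq : Summable fun k : ℤ => ((1 + |(k : ℝ)|) ^ 2)⁻¹ := by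
  have h : Summable fun n : ℕ => ((1 + (n : ℝ)) ^ 2)⁻¹ := by
    have := (summable_nat_add_iff 1).2 (Real.summable_nat_pow_inv.2 (one_lt_two))
    refine this.congr fun n => ?_
    push_cast
    rw [add_comm]
  exact Summable.of_nat_of_neg (by simpa using h) (by simpa using h)

theorem pairing_bound {a : ℤ → ℂ} {N : ℕ} {C : ℝ} (ha : ∀ k, ‖a k‖ ≤ C * (1 + |(k : ℝ)|) ^ N)
    (f : TestFun) {M : ℝ} (hM : ∀ j ≤ N + 2, ∀ t : ℝ, ‖iteratedDeriv j f.lift t‖ ≤ M) (k : ℤ) :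
    ‖f.coeff k * a (-k)‖ ≤ C * (2 ^ (N + 2) * M) * ((1 + |(k : ℝ)|) ^ 2)⁻¹ := by
  have h1 := f.decay (N + 2) M hM k
  have h2 := ha (-k)
  rw [Int.cast_neg, abs_neg] at h2
  have hC : 0 ≤ C := by
    have := (norm_nonneg _).trans (ha 0)
    simpa using this
  have hk : (0 : ℝ) < 1 + |(k : ℝ)| := by positivity
  rw [norm_mul, ← div_eq_mul_inv, le_div_iff₀ (by positivity)]
  calc ‖f.coeff k‖ * ‖a (-k)‖ * (1 + |(k : ℝ)|) ^ 2
      ≤ ‖f.coeff k‖ * (C * (1 + |(k : ℝ)|) ^ N) * (1 + |(k : ℝ)|) ^ 2 := by gcongr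
    _ = C * (‖f.coeff k‖ * (1 + |(k : ℝ)|) ^ (N + 2)) := by rw [pow_add]; ring
    _ ≤ _ := by gcongr

theorem pairing_summable {a : ℤ → ℂ}
    (ha : ∃ (N : ℕ) (C : ℝ), ∀ k : ℤ, ‖a k‖ ≤ C * (1 + |(k : ℝ)|) ^ N) (f : TestFun) :
    Summable fun k : ℤ => f.coeff k * a (-k) := by
  obtain ⟨N, C, h⟩ := ha
  obtain ⟨M, hM⟩ := f.exists_bound (N + 2)
  exact Summable.of_norm_bounded (summable_inv_sq.mul_left _) (pairing_bound h f hM)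

/-- The distribution `f ↦ ∑ f̂(k) a(-k)`, with Fourier coefficients `a(k)` of polynomial growth. -/
def Distribution.ofCoeff (a : ℤ → ℂ)
    (ha : ∃ (N : ℕ) (C : ℝ), ∀ k : ℤ, ‖a k‖ ≤ C * (1 + |(k : ℝ)|) ^ N) : Distribution :=
  ⟨{ toFun := fun f => ∑' k : ℤ, f.coeff k * a (-k)
     map_add' := fun f g => by
      simp only [TestFun.coeff_add, add_mul]
      exact (pairing_summable ha f).tsum_add (pairing_summable ha g)
     map_smul' := fun c f => by
      simp only [TestFun.coeff_smul, mul_assoc, RingHom.id_apply, smul_eq_mul]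
      exact tsum_mul_left }, by
    obtain ⟨N, C, h⟩ := ha
    refine ⟨N + 2, C * 2 ^ (N + 2) * ∑' k : ℤ, ((1 + |(k : ℝ)|) ^ 2)⁻¹, fun f M hM => ?_⟩
    have h1 := tsum_of_norm_bounded (summable_inv_sq.hasSum.mul_left _) (pairing_bound h f hM)
    refine h1.trans (le_of_eq ?_)
    ring⟩

theorem coeff_monomial (j k : ℤ) : (monomial j).coeff k = if k = j then 1 else 0 := by
  have hpi : (Real.pi : ℂ) ≠ 0 := by exact_mod_cast Real.pi_ne_zero
  have h : ∀ t : ℝ, (monomial j).lift t * ((Circle.exp t ^ (-k) : Circle) : ℂ) =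
      ((Circle.exp t ^ (j - k) : Circle) : ℂ) := fun t => by
    simp only [TestFun.lift, monomial]
    rw [← Circle.coe_mul, ← zpow_add, sub_eq_add_neg]
  simp only [TestFun.coeff, h]
  split_ifs with hk
  · subst hk
    simp
    field_simp
  · have hne : ((j - k : ℤ) : ℂ) * Complex.I ≠ 0 :=
      mul_ne_zero (by exact_mod_cast sub_ne_zero.2 (Ne.symm hk)) Complex.I_ne_zero
    have h2 := intervalIntegral.integral_eq_sub_of_hasDerivAt (a := 0) (b := 2 * Real.pi)
      (fun t _ => hasDerivAt_exp_zpow (j - k) t)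
      ((continuous_const.mul (contDiff_exp_zpow (j - k)).continuous).intervalIntegrable _ _)
    rw [intervalIntegral.integral_const_mul] at h2
    simp only [Circle.exp_two_pi, Circle.exp_zero, one_zpow, sub_self] at h2
    rw [(mul_eq_zero.1 h2).resolve_left hne, mul_zero]

theorem Distribution.coeff_ofCoeff (a : ℤ → ℂ)
    (ha : ∃ (N : ℕ) (C : ℝ), ∀ k : ℤ, ‖a k‖ ≤ C * (1 + |(k : ℝ)|) ^ N) (k : ℤ) :
    (Distribution.ofCoeff a ha).coeff k = a k := by
  change ∑' l : ℤ, (monomial (-k)).coeff l * a (-l) = a k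
  rw [tsum_eq_single (-k)]
  · simp [coeff_monomial]
  · intro l hl
    simp [coeff_monomial, hl]

theorem Distribution.growth_abs (μ : Distribution) :
    ∃ (N : ℕ) (C : ℝ), ∀ k : ℤ,
      ‖((|k| : ℤ) : ℂ) * μ.coeff k‖ ≤ C * (1 + |(k : ℝ)|) ^ N := by
  obtain ⟨N, C, h⟩ := μ.growth
  refine ⟨N + 1, C, fun k => ?_⟩
  have h1 := h k
  have hk : (0 : ℝ) ≤ |(k : ℝ)| := abs_nonneg _
  rw [norm_mul, Complex.norm_intCast]
  have h2 : |((|k| : ℤ) : ℝ)| ≤ 1 + |(k : ℝ)| := by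
    rw [Int.cast_abs, abs_abs]; linarith
  calc |((|k| : ℤ) : ℝ)| * ‖μ.coeff k‖ ≤ (1 + |(k : ℝ)|) * (C * (1 + |(k : ℝ)|) ^ N) := by gcongr
    _ = C * (1 + |(k : ℝ)|) ^ (N + 1) := by rw [pow_succ]; ring

/-- The modified differentiation operator `D` on distributions: the Fourier multiplier
`μ̂(k) ↦ |k| μ̂(k)`. -/
def absDeriv : Distribution →ₗ[ℂ] Distribution where
  toFun μ := Distribution.ofCoeff (fun k => ((|k| : ℤ) : ℂ) * μ.coeff k) μ.growth_abs
  map_add' μ ν := by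
    apply Subtype.ext
    ext f
    change ∑' k : ℤ, f.coeff k * (((|-k| : ℤ) : ℂ) * (μ.coeff (-k) + ν.coeff (-k))) =
      ∑' k : ℤ, f.coeff k * (((|-k| : ℤ) : ℂ) * μ.coeff (-k)) +
      ∑' k : ℤ, f.coeff k * (((|-k| : ℤ) : ℂ) * ν.coeff (-k))
    simp only [mul_add]
    exact (pairing_summable μ.growth_abs f).tsum_add (pairing_summable ν.growth_abs f)
  map_smul' c μ := by
    apply Subtype.ext
    ext f
    change ∑' k : ℤ, f.coeff k * (((|-k| : ℤ) : ℂ) * (c * μ.coeff (-k))) =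
      c * ∑' k : ℤ, f.coeff k * (((|-k| : ℤ) : ℂ) * μ.coeff (-k))
    rw [← tsum_mul_left]
    exact tsum_congr fun k => by ring

theorem coeff_absDeriv (μ : Distribution) (k : ℤ) :
    (absDeriv μ).coeff k = ((|k| : ℤ) : ℂ) * μ.coeff k :=
  Distribution.coeff_ofCoeff _ _ k

/-- `μ` has order `N`: `N` is the least natural number with `|μ̂(k)| ≲ (1 + |k|)^N`. -/
def Distribution.HasOrder (μ : Distribution) (N : ℕ) : Prop :=
  IsLeast {n : ℕ | ∃ C : ℝ, ∀ k : ℤ, ‖μ.coeff k‖ ≤ C * (1 + |(k : ℝ)|) ^ n} N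

/-! ### Harmonically weighted Dirichlet integrals and allowable tuples -/

/-- The Poisson extension `∑_{k ≥ 0} a(k) z^k + ∑_{k ≥ 1} a(-k) z̄^k` of the function or
distribution with Fourier coefficients `a`. -/
def poisson (a : ℤ → ℂ) (z : ℂ) : ℂ :=
  ∑' k : ℕ, a k * z ^ k + ∑' k : ℕ, a (-((k : ℤ) + 1)) * conj z ^ (k + 1)

/-- The test functions that are analytic: `f̂(k) = 0` for `k < 0`. -/
def analyticSubmodule : Submodule ℂ TestFun where
  carrier := {f | ∀ k : ℤ, k < 0 → f.coeff k = 0}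
  add_mem' hf hg k hk := by rw [TestFun.coeff_add, hf k hk, hg k hk, add_zero]
  zero_mem' k _ := by
    have := TestFun.coeff_smul 0 0 k
    simpa using this
  smul_mem' c f hf k hk := by rw [TestFun.coeff_smul, hf k hk, mul_zero]

/-- The type of analytic test functions. -/
abbrev AnalyticTest : Type := analyticSubmodule

/-- The extension of `f` to the disc, `z ↦ ∑ f̂(k) z^k`. -/
def AnalyticTest.extend (f : AnalyticTest) : ℂ → ℂ := poisson (f : TestFun).coeff

/-- The analytic test function `z f`. -/
def AnalyticTest.mulZ (f : AnalyticTest) : AnalyticTest :=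
  ⟨(f : TestFun).mulZ, fun k hk => by
    rw [TestFun.coeff_mulZ]; exact f.2 (k - 1) (by omega)⟩

/-- The constant function `1`. -/
def AnalyticTest.one : AnalyticTest :=
  ⟨monomial 0, fun k hk => by rw [coeff_monomial, if_neg hk.ne]⟩

/-- The integrals whose limit as `r → 1-` is the weighted Dirichlet integral of order `i`. -/
def dirichletApprox (μ : Distribution) : ℕ → AnalyticTest → ℝ → ℂ
  | 0, f, r => (2 * Real.pi : ℂ)⁻¹ * ∫ t in (0 : ℝ)..2 * Real.pi,
      (‖f.extend (r * (Circle.exp t : ℂ))‖ ^ 2 : ℝ) * poisson μ.coeff (r * (Circle.exp t : ℂ))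
  | i + 1, f, r => (Real.pi * (i + 1)! * i ! : ℂ)⁻¹ * ∫ z in Metric.ball (0 : ℂ) r,
      (‖iteratedDeriv (i + 1) f.extend z‖ ^ 2 : ℝ) * poisson μ.coeff z * ((1 - ‖z‖ ^ 2) ^ i : ℝ)

/-- The harmonically weighted Dirichlet integral `D_{μ,i}(f)` of order `i`. -/
def dirichletIntegral (μ : Distribution) (i : ℕ) (f : AnalyticTest) : ℂ :=
  Filter.limUnder (𝓝[<] (1 : ℝ)) (dirichletApprox μ i f)

/-- The quadratic form `‖f‖²_μ = ∑_{i < n} D_{μ_i,i}(f)` of an `n`-tuple of distributions. -/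
def tupleForm {n : ℕ} (μ : Fin n → Distribution) (f : AnalyticTest) : ℂ :=
  ∑ i : Fin n, dirichletIntegral (μ i) i f

open scoped ComplexOrder in
/-- `μ` is a normalized allowable `n`-tuple: `‖1‖²_μ = 1` and `0 ≤ ‖z f‖²_μ ≤ C ‖f‖²_μ` for all
analytic test functions `f`, the limits that define the form being genuine ones. The order on `ℂ`
is the one for which `0 ≤ w` says that `w` is real and non-negative. -/
structure IsNormalizedAllowable {n : ℕ} (μ : Fin n → Distribution) : Prop where
  tendsto : ∀ (i : Fin n) (f : AnalyticTest),
    Filter.Tendsto (dirichletApprox (μ i) i f) (𝓝[<] 1) (𝓝 (dirichletIntegral (μ i) i f))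
  form_one : tupleForm μ AnalyticTest.one = 1
  bounded : ∃ C : ℝ, 0 < C ∧ ∀ f : AnalyticTest,
    0 ≤ tupleForm μ f.mulZ ∧ tupleForm μ f.mulZ ≤ (C : ℂ) * tupleForm μ f

/-! ### Higher order isometries and their tuples -/

section Operators

variable {H : Type*} [NormedAddCommGroup H] [InnerProductSpace ℂ H] [CompleteSpace H]

/-- The defect operators: `Δ⁽⁰⁾ = I`, `Δ⁽ⁿ⁺¹⁾ = T* Δ⁽ⁿ⁾ T - Δ⁽ⁿ⁾`. -/
def defect (T : H →L[ℂ] H) : ℕ → (H →L[ℂ] H)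
  | 0 => ContinuousLinearMap.id ℂ H
  | n + 1 => (ContinuousLinearMap.adjoint T).comp ((defect T n).comp T) - defect T n

/-- `T` is expansive: `‖T x‖ ≥ ‖x‖`. -/
def IsExpansive (T : H →L[ℂ] H) : Prop := ∀ x : H, ‖x‖ ≤ ‖T x‖

/-- `T` is a strict `n`-isometry: an `n`-isometry but not an `(n-1)`-isometry (`n ≥ 1`). -/
def IsStrictIsometry (T : H →L[ℂ] H) (n : ℕ) : Prop := defect T n = 0 ∧ defect T (n - 1) ≠ 0

/-- `e` is a cyclic vector for `T`. -/
def IsCyclicVector (T : H →L[ℂ] H) (e : H) : Prop :=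
  (Submodule.span ℂ (Set.range fun k : ℕ => (T ^ k) e)).topologicalClosure = ⊤

/-- `μ` is the `n`-tuple of `T` and the vector `e`:
`μ̂_i(k) = conj (μ̂_i(-k)) = ⟨Δ⁽ⁱ⁾ e, T^k e⟩` for `k ≥ 0`, the inner product being linear in its
first entry. (Mathlib's `inner ℂ x y` is linear in `y`.) -/
def IsTupleOf {n : ℕ} (T : H →L[ℂ] H) (e : H) (μ : Fin n → Distribution) : Prop :=
  ∀ (i : Fin n) (k : ℕ),
    (μ i).coeff k = inner ℂ ((T ^ k) e) (defect T i e) ∧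
    conj ((μ i).coeff (-(k : ℤ))) = inner ℂ ((T ^ k) e) (defect T i e)

/-- `J` exhibits the Hilbert space `H` as the completion `D_μ` of the analytic test functions
(modulo those of norm zero) for the norm `‖·‖_μ`, with `T` corresponding to the operator that
`f ↦ z f` induces on `D_μ`, and `e` to the constant function `1`. -/
structure IsModelMap {n : ℕ} (μ : Fin n → Distribution) (T : H →L[ℂ] H) (e : H)
    (J : AnalyticTest →ₗ[ℂ] H) : Prop where
  norm_sq : ∀ f : AnalyticTest, ((‖J f‖ ^ 2 : ℝ) : ℂ) = tupleForm μ f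
  dense : DenseRange J
  map_mulZ : ∀ f : AnalyticTest, J f.mulZ = T (J f)
  map_one : J AnalyticTest.one = e

end Operators

/-- The operator `∏_{j = a}^{b} (D + j)` on distributions. -/
def prodAbsDeriv (a b : ℤ) : Distribution →ₗ[ℂ] Distribution :=
  Polynomial.aeval absDeriv
    (∏ j ∈ Finset.Icc a b, (Polynomial.X + Polynomial.C (j : ℂ)))

end HigherDirichlet
end

/-! Everything is computed on the orbit `z^a = T^a 1`, whose span is dense, and both norms are
determined by Gram matrices of this orbit.

The defect of `T` has rank one. Write `f = p + (z-λ)^m h` and let `c` be the coefficient of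
`z^(m-1)` in `p`. Then `zp - c(z-λ)^m` again has degree `< m`, so the shift sends `h` to `zh + c`;
since `z` is isometric on `H²` and `zH²` is orthogonal to constants, `⟨Tf, Tg⟩` differs from `⟨f,
g⟩` only by the product of the two top coefficients (`LocalDirichlet.inner_shift`). The polynomial
part of `z^a` is its Taylor polynomial at `λ`, with top coefficient `C(a, m-1) λ^(a-m+1)`. With `q =
m-1`, the first difference in `a` of `⟨T^a 1, T^(a+k) 1⟩` is therefore `λ̄^k C(a,q) C(a+k,q)`.

Iterated differences of such Gram entries are the entries of the defect operators. Vandermonde's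
identity gives the Newton expansion of `C(a,q) C(a+k,q)` in `a`, with coefficients `C(n,q) C(k+q,
2q-n)`, and these are the values `⟨Δ⁽ⁿ⁺¹⁾ 1, T^k 1⟩` up to `λ̄^k`. The degree in `a` is `2q`, whence
`Δ⁽²ᵐ⁾ = 0` by cyclicity, while `C(2q,q) ≠ 0` gives strictness. As a function of `|k|`, `C(|k|+q,
2m-1-i)` is a falling factorial divided by `(2m-1-i)!`; this is the multiplier `∏ (D+j)` acting on
`δ_λ`, and its degree in `|k|` is the order.

To identify the norms, termwise integration in polar coordinates and dominated convergence as `r →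
1` give `D_{μ,i}(f) = ∑ f̂(a) conj(f̂(b)) C(min(a,b), i) μ̂(b-a)` (`tendsto_dirichletApprox`).
Newton's formula for an `n`-isometry says that `⟨T^a e, T^b e⟩ = ∑_i C(min(a,b), i) μ̂_i(b-a)`
(`IsTupleOf.inner_pow`). Summing over `i` matches `‖f‖²_μ` with the norm of `∑ f̂(n) T^n 1`. Density
is cyclicity, and allowability is boundedness of `T`. -/

noncomputable section

namespace HigherDirichlet

open MeasureTheory

/-! ### Fourier series of test functions and uniqueness of Fourier coefficients -/

/-- The Fourier series of a continuous periodic function with summable Fourier coefficients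
converges pointwise to the function. -/
theorem hasSum_fourier_of_summable {g : ℝ → ℂ} (hg : Continuous g)
    (hp : Function.Periodic g (2 * Real.pi)) {c : ℤ → ℂ}
    (hc : ∀ k : ℤ, c k = (2 * Real.pi : ℂ)⁻¹ * ∫ t in (0 : ℝ)..2 * Real.pi,
      g t * ((Circle.exp t ^ (-k) : Circle) : ℂ))
    (hs : Summable c) (t : ℝ) :
    HasSum (fun k : ℤ => c k * ((Circle.exp t ^ k : Circle) : ℂ)) (g t) := by
  have : Fact (0 < 2 * Real.pi) := ⟨by positivity⟩
  have hpi : (Real.pi : ℂ) ≠ 0 := by exact_mod_cast Real.pi_ne_zero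
  have hF : ∀ (k : ℤ) (x : ℝ), fourier k (x : AddCircle (2 * Real.pi)) =
      ((Circle.exp x ^ k : Circle) : ℂ) := by
    intro k x
    rw [fourier_coe_apply, Circle.coe_zpow, Circle.coe_exp, ← Complex.exp_int_mul]
    congr 1
    push_cast
    field_simp
  let G : C(AddCircle (2 * Real.pi), ℂ) := ⟨hp.lift, by
    exact continuous_coinduced_dom.mpr hg⟩
  have hG : ∀ x : ℝ, G (x : AddCircle (2 * Real.pi)) = g x := fun x => hp.lift_coe x
  have hco : fourierCoeff G = c := by
    ext k
    rw [fourierCoeff_eq_intervalIntegral _ k 0, hc k, zero_add, Complex.real_smul]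
    congr 1
    · push_cast; ring
    · refine intervalIntegral.integral_congr fun x _ => ?_
      simp only [hG, hF, smul_eq_mul]
      ring
  have h := has_pointwise_sum_fourier_series_of_summable (f := G) (by rw [hco]; exact hs) t
  simpa only [hco, hG, hF, smul_eq_mul] using h

/-- Two derivatives beyond `N` buy a factor `(1+|k|)^(-2)`, which is summable over `ℤ`. -/
theorem TestFun.summable_coeff (f : TestFun) (N : ℕ) :
    Summable fun k : ℤ => ‖f.coeff k‖ * (1 + |(k : ℝ)|) ^ N := by
  obtain ⟨M, hM⟩ := f.exists_bound (N + 2)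
  refine Summable.of_nonneg_of_le (fun k => by positivity) (fun k => ?_)
    (summable_inv_sq.mul_left (2 ^ (N + 2) * M))
  have h := f.decay (N + 2) M hM k
  have hk : (0 : ℝ) < 1 + |(k : ℝ)| := by positivity
  rw [← div_eq_mul_inv, le_div_iff₀ (by positivity), mul_assoc, ← pow_add]
  exact h

theorem TestFun.iteratedDeriv_periodic (f : TestFun) (j : ℕ) :
    Function.Periodic (iteratedDeriv j f.lift) (2 * Real.pi) := by
  induction j with
  | zero => simpa using f.lift_periodic
  | succ j ih =>
    intro t
    rw [iteratedDeriv_succ, ← deriv_comp_add_const, funext ih]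

theorem norm_coeff_pow_le (c : ℂ) (k : ℤ) {j N : ℕ} (hj : j ≤ N) :
    ‖(k * Complex.I) ^ j * c‖ ≤ ‖c‖ * (1 + |(k : ℝ)|) ^ N := by
  have hk : (0 : ℝ) ≤ |(k : ℝ)| := abs_nonneg _
  rw [norm_mul, norm_pow, norm_mul, Complex.norm_I, mul_one, Complex.norm_intCast, mul_comm]
  gcongr
  calc |(k : ℝ)| ^ j ≤ (1 + |(k : ℝ)|) ^ j := by gcongr; linarith
    _ ≤ (1 + |(k : ℝ)|) ^ N := pow_le_pow_right₀ (by linarith) hj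

/-- The differentiated Fourier series of a test function. -/
theorem TestFun.hasSum_iteratedDeriv (f : TestFun) (j : ℕ) (t : ℝ) :
    HasSum (fun k : ℤ => (k * Complex.I) ^ j * f.coeff k * ((Circle.exp t ^ k : Circle) : ℂ))
      (iteratedDeriv j f.lift t) := by
  refine hasSum_fourier_of_summable
    (f.contDiff_lift.continuous_iteratedDeriv j (by exact_mod_cast le_top))
    (f.iteratedDeriv_periodic j) (fun k => ?_) ?_ t
  · rw [integral_iteratedDeriv_mul j f.contDiff_lift f.lift_periodic k, TestFun.coeff]
    ring
  · exact Summable.of_norm_bounded (f.summable_coeff j) fun k => norm_coeff_pow_le _ k le_rfl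

theorem lift_sum_smul_monomial (c : ℤ → ℂ) (s : Finset ℤ) (t : ℝ) :
    TestFun.lift (∑ k ∈ s, c k • monomial k) t =
      ∑ k ∈ s, c k * ((Circle.exp t ^ k : Circle) : ℂ) := by
  simp [TestFun.lift, monomial, Finset.sum_apply]

theorem iteratedDeriv_sum_smul_monomial (c : ℤ → ℂ) (s : Finset ℤ) (j : ℕ) (t : ℝ) :
    iteratedDeriv j (TestFun.lift (∑ k ∈ s, c k • monomial k)) t =
      ∑ k ∈ s, (k * Complex.I) ^ j * c k * ((Circle.exp t ^ k : Circle) : ℂ) := by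
  induction j generalizing t with
  | zero => simp [lift_sum_smul_monomial]
  | succ j ih =>
    rw [iteratedDeriv_succ, funext ih]
    have h := HasDerivAt.fun_sum (u := s) (x := t) fun (k : ℤ) _ =>
      (hasDerivAt_exp_zpow k t).const_mul ((k * Complex.I) ^ j * c k)
    rw [h.deriv]
    exact Finset.sum_congr rfl fun k _ => by ring

/-- A distribution is determined by its Fourier coefficients. -/
theorem Distribution.ext_coeff {μ ν : Distribution} (h : ∀ k, μ.coeff k = ν.coeff k) : μ = ν := by
  apply Subtype.ext
  ext f
  obtain ⟨N, C, hC⟩ := (μ - ν).2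
  rw [← sub_eq_zero, ← norm_eq_zero]
  refine le_antisymm ?_ (norm_nonneg _)
  -- The tail of `u` bounds all derivatives of order at most `N` of the Fourier remainder of `f`
  -- uniformly. It thus serves as `M` in the continuity estimate for `μ - ν`, which vanishes on
  -- trigonometric polynomials.
  set u : ℤ → ℝ := fun k => ‖f.coeff k‖ * (1 + |(k : ℝ)|) ^ N
  have hu : Summable u := f.summable_coeff N
  have hlim := (tendsto_tsum_compl_atTop_zero u).const_mul C
  rw [mul_zero] at hlim
  refine ge_of_tendsto' hlim fun s => ?_
  have h0 : ((μ - ν : Distribution) : Module.Dual ℂ TestFun)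
      (∑ k ∈ s, f.coeff k • monomial k) = 0 := by
    rw [map_sum]
    refine Finset.sum_eq_zero fun k _ => ?_
    have hk := h (-k)
    simp only [Distribution.coeff, neg_neg] at hk
    rw [map_smul]
    change f.coeff k • ((μ : Module.Dual ℂ TestFun) (monomial k) -
      (ν : Module.Dual ℂ TestFun) (monomial k)) = 0
    rw [hk, sub_self, smul_zero]
  have h1 := hC (f - ∑ k ∈ s, f.coeff k • monomial k) (∑' k : { k // k ∉ s }, u k) ?_
  · rw [map_sub, h0, sub_zero] at h1
    exact h1
  · intro j hj t
    have hl : TestFun.lift (f - ∑ k ∈ s, f.coeff k • monomial k) =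
      f.lift - TestFun.lift (∑ k ∈ s, f.coeff k • monomial k) := rfl
    rw [hl, iteratedDeriv_sub
      ((f.contDiff_lift.of_le (by exact_mod_cast le_top)).contDiffAt)
      (((TestFun.contDiff_lift _).of_le (by exact_mod_cast le_top)).contDiffAt),
      iteratedDeriv_sum_smul_monomial]
    have h2 : HasSum (fun k : { k // k ∉ s } => ((k : ℤ) * Complex.I) ^ j * f.coeff k *
        ((Circle.exp t ^ (k : ℤ) : Circle) : ℂ)) (iteratedDeriv j f.lift t -
        ∑ k ∈ s, (k * Complex.I) ^ j * f.coeff k * ((Circle.exp t ^ k : Circle) : ℂ)) := by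
      have := (s.hasSum_compl_iff (f := fun k : ℤ => (k * Complex.I) ^ j * f.coeff k *
        ((Circle.exp t ^ k : Circle) : ℂ)) (a := iteratedDeriv j f.lift t -
        ∑ k ∈ s, (k * Complex.I) ^ j * f.coeff k * ((Circle.exp t ^ k : Circle) : ℂ))).2
      apply this
      rw [sub_add_cancel]
      exact f.hasSum_iteratedDeriv j t
    rw [← h2.tsum_eq]
    refine tsum_of_norm_bounded (hu.subtype _).hasSum fun k => ?_
    rw [norm_mul, Circle.norm_coe, mul_one]
    exact norm_coeff_pow_le _ _ hj

/-! ### Fourier coefficients of the explicit distributions -/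

theorem Distribution.coeff_smul (c : ℂ) (μ : Distribution) (k : ℤ) :
    (c • μ).coeff k = c * μ.coeff k := rfl

theorem Distribution.coeff_add (μ ν : Distribution) (k : ℤ) :
    (μ + ν).coeff k = μ.coeff k + ν.coeff k := rfl

theorem coeff_dirac (lam : Circle) (k : ℤ) :
    (dirac lam).coeff k = ((lam ^ (-k) : Circle) : ℂ) := rfl

theorem coeff_lebesgue (k : ℤ) : lebesgue.coeff k = if k = 0 then 1 else 0 := by
  change (monomial (-k)).coeff 0 = _
  rw [coeff_monomial]
  simp only [zero_eq_neg]

/-- A polynomial in `D` acts on Fourier coefficients through its values at `|k|`. -/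
theorem coeff_aeval_absDeriv (P : Polynomial ℂ) (μ : Distribution) (k : ℤ) :
    (Polynomial.aeval absDeriv P μ).coeff k = P.eval ((|k| : ℤ) : ℂ) * μ.coeff k := by
  induction P using Polynomial.induction_on' with
  | add p q hp hq =>
    rw [map_add, LinearMap.add_apply, Distribution.coeff_add, hp, hq, Polynomial.eval_add, add_mul]
  | monomial n a =>
    rw [Polynomial.aeval_monomial, Module.End.mul_apply, Module.algebraMap_end_apply,
      Distribution.coeff_smul, Polynomial.eval_monomial, mul_assoc]
    congr 1
    induction n with
    | zero => simp
    | succ n ih => rw [pow_succ', Module.End.mul_apply, coeff_absDeriv, ih, pow_succ]; ring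

theorem coeff_prodAbsDeriv (a b : ℤ) (μ : Distribution) (k : ℤ) :
    (prodAbsDeriv a b μ).coeff k =
      (∏ j ∈ Finset.Icc a b, (((|k| : ℤ) : ℂ) + (j : ℂ))) * μ.coeff k := by
  rw [prodAbsDeriv, coeff_aeval_absDeriv, Polynomial.eval_prod]
  simp

/-- The factors are `n+q, n+q-1, …` downwards, `N` of them. The condition `N ≤ q` keeps the
truncated subtraction in `descFactorial` honest; the induction adds a new lower endpoint. -/
theorem prod_Icc_add_eq_descFactorial (n q N : ℕ) (hN : N ≤ q) :
    ∏ j ∈ Finset.Icc ((q : ℤ) + 1 - N) q, ((n : ℂ) + (j : ℂ)) = ((n + q).descFactorial N : ℂ) := by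
  induction N with
  | zero => simp
  | succ N ih =>
    have h1 : Finset.Icc ((q : ℤ) + 1 - (N + 1 : ℕ)) q =
        insert ((q : ℤ) - N) (Finset.Icc ((q : ℤ) + 1 - N) q) := by
      ext x
      simp only [Finset.mem_insert, Finset.mem_Icc]
      omega
    rw [h1, Finset.prod_insert (by simp), ih (by omega), Nat.descFactorial_succ,
      Nat.cast_mul, Nat.cast_sub (by omega)]
    push_cast
    ring

/-- The distribution with Fourier coefficients `k ↦ λ̄ᵏ C(i-1, m-1) C(|k|+m-1, 2m-1-i)`. -/
def localDistribution (m : ℕ) (lam : Circle) (i : ℕ) : Distribution :=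
  ((Nat.choose (i - 1) (m - 1) : ℂ) / (Nat.factorial (2 * m - 1 - i) : ℂ)) •
    prodAbsDeriv ((i : ℤ) + 1 - m) ((m : ℤ) - 1) (dirac lam)

theorem coeff_localDistribution (m : ℕ) (lam : Circle) (i : ℕ) (hi : i < 2 * m) (h0 : 1 ≤ i)
    (k : ℤ) : (localDistribution m lam i).coeff k =
      ((Nat.choose (i - 1) (m - 1) * Nat.choose (k.natAbs + (m - 1)) (2 * m - 1 - i) : ℕ) : ℂ) *
        ((lam ^ (-k) : Circle) : ℂ) := by
  rw [localDistribution, Distribution.coeff_smul, coeff_prodAbsDeriv, coeff_dirac]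
  -- For `i < m` the factor `C(i-1, m-1)` kills both sides. For `i ≥ m` the product has `2m-1-i ≤
  -- m-1` factors and is a falling factorial, whose factorial cancels the denominator.
  rcases lt_or_ge i m with h | h
  · rw [Nat.choose_eq_zero_of_lt (show i - 1 < m - 1 by omega)]
    simp
  · have h1 := prod_Icc_add_eq_descFactorial k.natAbs (m - 1) (2 * m - 1 - i) (by omega)
    have h2 : (((m - 1 : ℕ) : ℤ) + 1 - ((2 * m - 1 - i : ℕ) : ℤ)) = (i : ℤ) + 1 - m := by omega
    have h3 : ((m - 1 : ℕ) : ℤ) = (m : ℤ) - 1 := by omega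
    have h4 : ((|k| : ℤ) : ℂ) = (k.natAbs : ℂ) := by
      rw [← Nat.cast_natAbs]
    rw [h2, h3] at h1
    rw [h4, h1, Nat.descFactorial_eq_factorial_mul_choose]
    have := Nat.factorial_ne_zero (2 * m - 1 - i)
    push_cast
    field_simp

theorem localDistribution_eq_zero (m : ℕ) (lam : Circle) (i : ℕ) (h0 : 1 ≤ i) (hi : i ≤ m - 1) :
    localDistribution m lam i = 0 := by
  rw [localDistribution, Nat.choose_eq_zero_of_lt (show i - 1 < m - 1 by omega)]
  simp

theorem localDistribution_last (m : ℕ) (hm : 1 ≤ m) (lam : Circle) :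
    localDistribution m lam (2 * m - 1) =
      (Nat.choose (2 * m - 2) (m - 1) : ℂ) • dirac lam := by
  apply Distribution.ext_coeff
  intro k
  rw [coeff_localDistribution m lam _ (by omega) (by omega), Distribution.coeff_smul, coeff_dirac,
    show 2 * m - 1 - 1 = 2 * m - 2 by omega]
  simp

/-- The modulus of the `k`-th coefficient is a positive constant times `C(|k|+m-1, N)`, a polynomial
of exact degree `N` in `|k|`. The lower bound uses `N ≤ m-1`, which is where `m ≤ i` enters. -/
theorem hasOrder_localDistribution (m : ℕ) (lam : Circle) (i : ℕ) (hm : 1 ≤ m) (h0 : m ≤ i)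
    (hi : i < 2 * m) : (localDistribution m lam i).HasOrder (2 * m - 1 - i) := by
  set N := 2 * m - 1 - i with hN
  set c := Nat.choose (i - 1) (m - 1)
  have hc : 1 ≤ c := Nat.choose_pos (by omega)
  have hnorm : ∀ k : ℤ, ‖(localDistribution m lam i).coeff k‖ =
      (c : ℝ) * (Nat.choose (k.natAbs + (m - 1)) N : ℝ) := by
    intro k
    rw [coeff_localDistribution m lam i hi (by omega), norm_mul, Circle.norm_coe, mul_one,
      Complex.norm_natCast]
    push_cast
    rfl
  have habs : ∀ k : ℤ, |(k : ℝ)| = (k.natAbs : ℝ) := fun k => by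
    rw [← Int.cast_abs, ← Nat.cast_natAbs]
  constructor
  · refine ⟨c * (m : ℝ) ^ N, fun k => ?_⟩
    rw [hnorm, habs, mul_assoc]
    gcongr
    calc (Nat.choose (k.natAbs + (m - 1)) N : ℝ) ≤ ((k.natAbs + (m - 1) : ℕ) : ℝ) ^ N := by
          exact_mod_cast Nat.choose_le_pow _ _
      _ ≤ ((m : ℝ) * (1 + k.natAbs)) ^ N := by
          gcongr
          have : k.natAbs + (m - 1) ≤ m * (1 + k.natAbs) := by
            have : k.natAbs ≤ m * k.natAbs := Nat.le_mul_of_pos_left _ hm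
            rw [mul_add]; omega
          exact_mod_cast this
      _ = _ := mul_pow _ _ _
  · rintro n ⟨C, hC⟩
    by_contra! hlt
    -- A growth exponent `n < N` would leave a whole factor `1+x` bounded: `(1+x)^N ≤ N! C(x+m-1,
    -- N)` because the smallest factor of the falling factorial is `x+m-N ≥ x+1`.
    have hb : ∀ x : ℕ, (1 + x : ℝ) ≤ C * N ! := by
      intro x
      have h1 := hC x
      rw [hnorm, habs, Int.natAbs_natCast] at h1
      have h2 : ((1 + x : ℝ)) ^ N ≤ N ! * (Nat.choose (x + (m - 1)) N : ℝ) := by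
        have h3 := Nat.pow_sub_le_descFactorial (x + (m - 1)) N
        rw [Nat.descFactorial_eq_factorial_mul_choose] at h3
        have h4 : (1 + x) ^ N ≤ (x + (m - 1) + 1 - N) ^ N := Nat.pow_le_pow_left (by omega) _
        exact_mod_cast h4.trans h3
      have h5 : (Nat.choose (x + (m - 1)) N : ℝ) ≤ c * Nat.choose (x + (m - 1)) N :=
        le_mul_of_one_le_left (by positivity) (by exact_mod_cast hc)
      have h6 : ((1 + x : ℝ)) ^ n * (1 + x) ≤ (1 + x) ^ n * (C * N !) := by
        calc ((1 + x : ℝ)) ^ n * (1 + x) = (1 + x) ^ (n + 1) := (pow_succ _ _).symm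
          _ ≤ (1 + x) ^ N := pow_le_pow_right₀ (by linarith [Nat.cast_nonneg (α := ℝ) x]) hlt
          _ ≤ N ! * (C * (1 + x) ^ n) := h2.trans (by gcongr; exact h5.trans h1)
          _ = _ := by ring
      exact le_of_mul_le_mul_left h6 (by positivity)
    obtain ⟨x, hx⟩ := exists_nat_gt (C * N !)
    linarith [hb x]

/-! ### Newton expansions and iterated differences -/

/-- By Pascal's rule the difference of `C(x,n)` is `C(x,n-1)`, so each difference shifts the
coefficient sequence by one. The vanishing of `d` from `K` on lets the summation range stay fixed.
-/
theorem fwdDiff_iter_newton (d : ℕ → ℂ) (K : ℕ) (hd : ∀ n, K ≤ n → d n = 0) (j a : ℕ) :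
    (fwdDiff 1)^[j] (fun x : ℕ => ∑ n ∈ Finset.range K, d n * (Nat.choose x n : ℂ)) a =
      ∑ n ∈ Finset.range K, d (n + j) * (Nat.choose a n : ℂ) := by
  induction j generalizing a with
  | zero => simp
  | succ j ih =>
    rw [Function.iterate_succ_apply', fwdDiff, ih, ih, ← Finset.sum_sub_distrib]
    rcases K with _ | K
    · simp
    · rw [Finset.sum_range_succ', Finset.sum_range_succ _ K, hd (K + (j + 1)) (by omega)]
      simp only [Nat.choose_succ_succ, Nat.choose_zero_right, Nat.cast_add]
      rw [sub_self, zero_mul]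
      congr 1
      refine Finset.sum_congr rfl fun n _ => ?_
      rw [show n + 1 + j = n + (j + 1) by ring]
      ring

/-- The Newton expansion of `x ↦ C(x, q) C(x + k, q)`. -/
theorem choose_mul_choose_eq_sum (q k x : ℕ) :
    Nat.choose x q * Nat.choose (x + k) q =
      ∑ n ∈ Finset.range (2 * q + 1),
        Nat.choose n q * Nat.choose (k + q) (2 * q - n) * Nat.choose x n := by
  rcases lt_or_ge x q with hx | hx
  · rw [Nat.choose_eq_zero_of_lt hx, zero_mul]
    refine (Finset.sum_eq_zero fun n _ => ?_).symm
    rcases lt_or_ge n q with hn | hn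
    · rw [Nat.choose_eq_zero_of_lt hn]; simp
    · rw [Nat.choose_eq_zero_of_lt (show x < n by omega)]; simp
  -- Terms with `n < q` vanish. Vandermonde splits `x+k = (x-q) + (k+q)`, and `C(x,q) C(x-q,n) =
  -- C(x,q+n) C(q+n,q)` turns the product into Newton form.
  · rw [show 2 * q + 1 = q + (q + 1) by ring, Finset.sum_range_add]
    rw [Finset.sum_eq_zero (fun n hn => by
      rw [Nat.choose_eq_zero_of_lt (Finset.mem_range.1 hn)]; simp), zero_add,
      show x + k = (x - q) + (k + q) by omega, Nat.add_choose_eq,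
      Finset.Nat.sum_antidiagonal_eq_sum_range_succ_mk, Finset.mul_sum]
    refine Finset.sum_congr rfl fun n hn => ?_
    have hn' : n ≤ q := by simpa [Nat.lt_succ_iff] using hn
    dsimp only
    rw [show 2 * q - (q + n) = q - n by omega]
    have h1 := Nat.choose_mul (n := x) (show q ≤ q + n by omega)
    rw [show q + n - q = n by omega] at h1
    rw [← mul_assoc, ← h1]
    ring

/-! ### Defect operators -/

section Operators

variable {H : Type*} [NormedAddCommGroup H] [InnerProductSpace ℂ H] [CompleteSpace H]

theorem inner_defect_succ (T : H →L[ℂ] H) (n : ℕ) (x y : H) :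
    inner ℂ y (defect T (n + 1) x) =
      inner ℂ (T y) (defect T n (T x)) - inner ℂ y (defect T n x) := by
  simp [defect, ContinuousLinearMap.adjoint_inner_right]

theorem inner_defect_comm (T : H →L[ℂ] H) (n : ℕ) (x y : H) :
    inner ℂ y (defect T n x) = conj (inner ℂ x (defect T n y)) := by
  induction n generalizing x y with
  | zero => simp [defect]
  | succ n ih => rw [inner_defect_succ, inner_defect_succ, ih, ih x y, map_sub]

/-- The defect operators are the iterated differences of `a ↦ T*ᵃ Tᵃ`. -/
theorem fwdDiff_iter_inner_pow (T : H →L[ℂ] H) (x y : H) (i a : ℕ) :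
    (fwdDiff 1)^[i] (fun a : ℕ => inner ℂ ((T ^ a) y) ((T ^ a) x)) a =
      inner ℂ ((T ^ a) y) (defect T i ((T ^ a) x)) := by
  induction i generalizing a with
  | zero => simp [defect]
  | succ i ih =>
    rw [Function.iterate_succ_apply', fwdDiff, ih, ih, inner_defect_succ, pow_succ']
    rfl

/-- Newton's forward difference formula at `0`, the differences being the entries of the defect
operators. -/
theorem inner_pow_eq_sum_defect (T : H →L[ℂ] H) (x y : H) (a : ℕ) :
    inner ℂ ((T ^ a) y) ((T ^ a) x) =
      ∑ i ∈ Finset.range (a + 1), (Nat.choose a i : ℂ) * inner ℂ y (defect T i x) := by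
  have h := shift_eq_sum_fwdDiff_iter 1 (fun a : ℕ => inner ℂ ((T ^ a) y) ((T ^ a) x)) a 0
  simp only [fwdDiff_iter_inner_pow] at h
  simpa using h

theorem defect_eq_zero_of_le (T : H →L[ℂ] H) {n : ℕ} (h : defect T n = 0) {i : ℕ} (hi : n ≤ i) :
    defect T i = 0 := by
  induction i, hi using Nat.le_induction with
  | base => exact h
  | succ i _ ih => simp [defect, ih]

/-- The range `a+1` in Newton's formula may be replaced by `n`: beyond `n` the defects vanish, and
beyond `a` the binomials do. The number of terms no longer depends on `a`, so one fixed tuple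
encodes the whole Gram matrix. -/
theorem inner_pow_eq_sum_defect_of_isometry (T : H →L[ℂ] H) {n : ℕ} (h : defect T n = 0) (x y : H)
    (a : ℕ) : inner ℂ ((T ^ a) y) ((T ^ a) x) =
      ∑ i ∈ Finset.range n, (Nat.choose a i : ℂ) * inner ℂ y (defect T i x) := by
  rw [inner_pow_eq_sum_defect]
  rcases le_total n (a + 1) with hn | hn
  · refine (Finset.sum_subset (Finset.range_subset_range.2 hn) fun i _ hi => ?_).symm
    rw [defect_eq_zero_of_le T h (by simpa using hi)]
    simp
  · refine Finset.sum_subset (Finset.range_subset_range.2 hn) fun i _ hi => ?_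
    rw [Nat.choose_eq_zero_of_lt (by have := Finset.mem_range.not.1 hi; omega)]
    simp

end Operators

/-- Each `A T^a e` is orthogonal to a dense subspace, hence zero; so `A` vanishes on a dense span.
-/
theorem eq_zero_of_isCyclicVector {H : Type*} [NormedAddCommGroup H] [InnerProductSpace ℂ H]
    {T A : H →L[ℂ] H} {e : H} (he : IsCyclicVector T e)
    (h : ∀ a b : ℕ, inner ℂ ((T ^ b) e) (A ((T ^ a) e)) = 0) : A = 0 := by
  have hd : Dense (Submodule.span ℂ (Set.range fun k : ℕ => (T ^ k) e) : Set H) :=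
    Submodule.dense_iff_topologicalClosure_eq_top.2 he
  have h1 : ∀ a : ℕ, A ((T ^ a) e) = 0 := by
    intro a
    refine hd.eq_zero_of_inner_right (𝕜 := ℂ) fun v hv => ?_
    induction hv using Submodule.span_induction with
    | mem x hx => obtain ⟨b, rfl⟩ := hx; exact h a b
    | zero => simp
    | add x y _ _ hx hy => rw [inner_add_left, hx, hy, add_zero]
    | smul c x _ hx => rw [inner_smul_left, hx, mul_zero]
  apply ContinuousLinearMap.ext_on hd
  rintro _ ⟨a, rfl⟩
  simpa using h1 a

/-! ### The shift on the Hardy space -/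

theorem H2.mulZ_add_const_zero (f : H2) (c : ℂ) : (H2.mulZ f + H2.const c : H2) 0 = c := by
  rw [lp.coeFn_add, Pi.add_apply]
  change 0 + H2.const c 0 = c
  simp [H2.const]

theorem H2.mulZ_add_const_succ (f : H2) (c : ℂ) (n : ℕ) :
    (H2.mulZ f + H2.const c : H2) (n + 1) = f n := by
  rw [lp.coeFn_add, Pi.add_apply]
  change f n + H2.const c (n + 1) = f n
  simp [H2.const]

/-- The Taylor coefficients of `zf + c` are `c` followed by those of `f`. -/
theorem H2.inner_mulZ_add_const (f g : H2) (c d : ℂ) :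
    inner ℂ (H2.mulZ f + H2.const c) (H2.mulZ g + H2.const d) = inner ℂ f g + conj c * d := by
  rw [lp.inner_eq_tsum, lp.inner_eq_tsum, (lp.summable_inner (𝕜 := ℂ) (H2.mulZ f + H2.const c)
    (H2.mulZ g + H2.const d)).tsum_eq_zero_add]
  simp only [H2.mulZ_add_const_zero, H2.mulZ_add_const_succ, RCLike.inner_apply]
  ring

theorem H2.const_zero : H2.const 0 = 0 := by simp [H2.const]

theorem H2.inner_mulZ (f g : H2) : inner ℂ (H2.mulZ f) (H2.mulZ g) = inner ℂ f g := by
  have h := H2.inner_mulZ_add_const f g 0 0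
  simpa [H2.const_zero] using h

/-- Multiplication by `z` on `H²` as a bounded operator. -/
def H2.mulZL : H2 →L[ℂ] H2 :=
  LinearMap.mkContinuous
    { toFun := H2.mulZ
      map_add' := fun f g => by
        ext n
        rw [lp.coeFn_add, Pi.add_apply]
        rcases n with _ | n
        · exact (add_zero 0).symm
        · rfl
      map_smul' := fun c f => by
        ext n
        rw [lp.coeFn_smul, Pi.smul_apply]
        rcases n with _ | n
        · exact (smul_zero c).symm
        · rfl } 1 fun f => by
    have h := H2.inner_mulZ f f
    rw [inner_self_eq_norm_sq_to_K, inner_self_eq_norm_sq_to_K] at h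
    have h2 : ‖H2.mulZ f‖ ^ 2 = ‖f‖ ^ 2 := by exact_mod_cast h
    rw [one_mul]
    exact ((pow_left_inj₀ (norm_nonneg _) (norm_nonneg _) two_ne_zero).1 h2).le

theorem H2.eval_mulZL_sub_pow (lam : ℂ) (m : ℕ) (f : H2) (z : ℂ) (hz : ‖z‖ < 1) :
    (((H2.mulZL - lam • ContinuousLinearMap.id ℂ H2) ^ m) f).eval z = (z - lam) ^ m * f.eval z := by
  induction m with
  | zero => simp
  | succ m ih =>
    rw [pow_succ']
    set g := ((H2.mulZL - lam • ContinuousLinearMap.id ℂ H2) ^ m) f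
    change (H2.mulZ g - lam • g).eval z = _
    rw [sub_eq_add_neg, ← neg_smul, H2.eval_add _ _ z hz, H2.eval_mulZ _ z hz,
      H2.eval_smul _ _ z hz, ih]
    ring

theorem H2.eval_sum_single (h : H2) (s : Finset ℕ) (z : ℂ) (hz : ‖z‖ < 1) :
    (∑ n ∈ s, lp.single 2 n (h n) : H2).eval z =
      (∑ n ∈ s, Polynomial.C (h n) * Polynomial.X ^ n : Polynomial ℂ).eval z := by
  classical
  induction s using Finset.induction_on with
  | empty => simp [H2.eval_zero z hz]
  | insert n s hn ih =>
    rw [Finset.sum_insert hn, Finset.sum_insert hn, H2.eval_add _ _ z hz, ih, Polynomial.eval_add]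
    congr 1
    rw [H2.eval, tsum_eq_single n]
    · simp
    · intro k hk
      simp [hk]

/-! ### The shift on the local Dirichlet space -/

namespace LocalDirichlet

variable {m : ℕ} {lam : Circle}

/-- The polynomial `p` is the polynomial part of `F = p + (z - λ)^m h`. -/
def IsTaylorPoly (F : LocalDirichlet m lam) (p : Polynomial ℂ) : Prop :=
  p ∈ Polynomial.degreeLT ℂ m ∧ ∀ z : ℂ, ‖z‖ < 1 →
    (F : WithLp 2 (H2 × H2)).fst.eval z =
      p.eval z + (z - lam) ^ m * (F : WithLp 2 (H2 × H2)).snd.eval z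

theorem exists_isTaylorPoly (F : LocalDirichlet m lam) : ∃ p, IsTaylorPoly F p := F.2

/-- The coefficient of degree `m` in `X p` is that of degree `m-1` in `p`, and `(X-λ)^m` is monic of
degree `m`, so the subtraction removes exactly this term. The subtracted constant is what the shift
passes on to `h`. -/
theorem X_mul_sub_mem_degreeLT (lam : ℂ) {p : Polynomial ℂ} (hp : p ∈ Polynomial.degreeLT ℂ m) :
    Polynomial.X * p - Polynomial.C (p.coeff (m - 1)) *
      (Polynomial.X - Polynomial.C lam) ^ m ∈ Polynomial.degreeLT ℂ m := by
  rw [Polynomial.mem_degreeLT, Polynomial.degree_lt_iff_coeff_zero] at hp ⊢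
  intro n hn
  have hmon : ((Polynomial.X - Polynomial.C lam) ^ m).Monic := (Polynomial.monic_X_sub_C _).pow m
  have hdeg : ((Polynomial.X - Polynomial.C lam) ^ m).natDegree = m := by
    simp [(Polynomial.monic_X_sub_C lam).natDegree_pow]
  rw [Polynomial.coeff_sub, Polynomial.coeff_C_mul]
  rcases hn.eq_or_lt with rfl | hlt
  · have h1 := hmon.coeff_natDegree
    rw [hdeg] at h1
    rw [h1]
    rcases m with _ | m
    · simp [hp 0 le_rfl]
    · simp [Polynomial.coeff_X_mul]
  · rw [Polynomial.coeff_eq_zero_of_natDegree_lt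
      (p := (Polynomial.X - Polynomial.C lam) ^ m) (by rw [hdeg]; exact hlt)]
    obtain ⟨n, rfl⟩ : ∃ k, n = k + 1 := ⟨n - 1, by omega⟩
    rw [Polynomial.coeff_X_mul, hp n (by omega)]
    simp

/-- The action of the shift on the pair `(f, h)` and on the polynomial part. -/
theorem shift_eq {F : LocalDirichlet m lam} {p : Polynomial ℂ} (h : IsTaylorPoly F p) :
    (shift m lam F : WithLp 2 (H2 × H2)).fst = H2.mulZ (F : WithLp 2 (H2 × H2)).fst ∧
    (shift m lam F : WithLp 2 (H2 × H2)).snd =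
      H2.mulZ (F : WithLp 2 (H2 × H2)).snd + H2.const (p.coeff (m - 1)) ∧
    IsTaylorPoly (shift m lam F) (Polynomial.X * p - Polynomial.C (p.coeff (m - 1)) *
      (Polynomial.X - Polynomial.C (lam : ℂ)) ^ m) := by
  obtain ⟨hp, hF⟩ := h
  have hG : ∀ z : ℂ, ‖z‖ < 1 → (H2.mulZ (F : WithLp 2 (H2 × H2)).fst).eval z =
      (Polynomial.X * p - Polynomial.C (p.coeff (m - 1)) *
        (Polynomial.X - Polynomial.C (lam : ℂ)) ^ m).eval z + (z - lam) ^ m *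
      (H2.mulZ (F : WithLp 2 (H2 × H2)).snd + H2.const (p.coeff (m - 1))).eval z := by
    intro z hz
    rw [H2.eval_mulZ _ z hz, H2.eval_add _ _ z hz, H2.eval_mulZ _ z hz, H2.eval_const, hF z hz]
    simp
    ring
  have hq := X_mul_sub_mem_degreeLT (lam : ℂ) hp
  have key : shift m lam F = ⟨WithLp.toLp 2 (H2.mulZ (F : WithLp 2 (H2 × H2)).fst,
      H2.mulZ (F : WithLp 2 (H2 × H2)).snd + H2.const (p.coeff (m - 1))), _, hq, hG⟩ := by
    apply eval_injective
    intro z hz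
    rw [eval_shift m lam F z hz]
    exact (H2.eval_mulZ _ z hz).symm
  rw [key]
  exact ⟨rfl, rfl, hq, hG⟩

theorem inner_def (F G : LocalDirichlet m lam) : inner ℂ F G =
    inner ℂ (F : WithLp 2 (H2 × H2)).fst (G : WithLp 2 (H2 × H2)).fst +
    inner ℂ (F : WithLp 2 (H2 × H2)).snd (G : WithLp 2 (H2 × H2)).snd := rfl

/-- The first components contribute no change since `z` is isometric on `H²`; in the second the
shift adds a constant, orthogonal to `zH²`. Thus `T*T - I` has rank at most one, and all later
formulas are iterated differences of this identity. -/
theorem inner_shift {F G : LocalDirichlet m lam} {p q : Polynomial ℂ} (hF : IsTaylorPoly F p)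
    (hG : IsTaylorPoly G q) : inner ℂ (shift m lam F) (shift m lam G) =
      inner ℂ F G + conj (p.coeff (m - 1)) * q.coeff (m - 1) := by
  obtain ⟨h1, h2, -⟩ := shift_eq hF
  obtain ⟨h3, h4, -⟩ := shift_eq hG
  rw [inner_def, inner_def, h1, h2, h3, h4, H2.inner_mulZ, H2.inner_mulZ_add_const]
  ring

theorem isExpansive_shift (m : ℕ) (lam : Circle) : IsExpansive (shift m lam) := by
  intro F
  obtain ⟨p, hp⟩ := exists_isTaylorPoly F
  have h := congrArg Complex.re (inner_shift hp hp)
  rw [← Complex.normSq_eq_conj_mul_self, Complex.add_re, Complex.ofReal_re] at h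
  have h1 : ‖F‖ ^ 2 ≤ ‖shift m lam F‖ ^ 2 := by
    rw [← inner_self_eq_norm_sq (𝕜 := ℂ), ← inner_self_eq_norm_sq (𝕜 := ℂ)]
    change (inner ℂ F F).re ≤ (inner ℂ (shift m lam F) (shift m lam F)).re
    linarith [Complex.normSq_nonneg (p.coeff (m - 1))]
  exact le_of_sq_le_sq h1 (norm_nonneg _)

/-- The Taylor polynomial at `λ` of degree at most `q` of `zᵃ`. -/
def taylorPow (lam : Circle) (q a : ℕ) : Polynomial ℂ :=
  ∑ j ∈ Finset.range (q + 1),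
    Polynomial.C ((Nat.choose a j : ℂ) * (lam : ℂ) ^ a * conj (lam : ℂ) ^ j) *
      (Polynomial.X - Polynomial.C (lam : ℂ)) ^ j

/-- Expand `X = λ + (X-λ)` and use Pascal's rule. The last term is the overshoot of degree `q+1`,
the very multiple of `(X-λ)^m` that `shift_eq` subtracts when `q = m-1`. -/
theorem X_mul_taylorPow (lam : Circle) (q a : ℕ) :
    Polynomial.X * taylorPow lam q a = taylorPow lam q (a + 1) +
      Polynomial.C ((Nat.choose a q : ℂ) * (lam : ℂ) ^ a * conj (lam : ℂ) ^ q) *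
        (Polynomial.X - Polynomial.C (lam : ℂ)) ^ (q + 1) := by
  have hlam : Polynomial.C (lam : ℂ) * Polynomial.C (conj (lam : ℂ)) = 1 := by
    rw [← Polynomial.C_mul, Complex.mul_conj, Circle.normSq_coe]
    simp
  induction q with
  | zero => simp [taylorPow]; ring
  | succ q ih =>
    have h1 : ∀ b, taylorPow lam (q + 1) b = taylorPow lam q b +
        Polynomial.C ((Nat.choose b (q + 1) : ℂ) * (lam : ℂ) ^ b * conj (lam : ℂ) ^ (q + 1)) *
        (Polynomial.X - Polynomial.C (lam : ℂ)) ^ (q + 1) := fun b => Finset.sum_range_succ _ _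
    rw [h1, h1, mul_add, ih, Nat.choose_succ_succ]
    simp only [Polynomial.C_mul, Polynomial.C_pow, Nat.cast_add, Polynomial.C_add]
    linear_combination (-(Polynomial.C (Nat.choose a q : ℂ) * Polynomial.C (lam : ℂ) ^ a *
      Polynomial.C (conj (lam : ℂ)) ^ q *
      (Polynomial.X - Polynomial.C (lam : ℂ)) ^ (q + 1))) * hlam

theorem coeff_taylorPow (lam : Circle) (q a : ℕ) :
    (taylorPow lam q a).coeff q = (Nat.choose a q : ℂ) * (lam : ℂ) ^ a * conj (lam : ℂ) ^ q := by
  rw [taylorPow, Polynomial.finsetSum_coeff, Finset.sum_range_succ]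
  have hdeg : ∀ j, ((Polynomial.X - Polynomial.C (lam : ℂ)) ^ j).natDegree = j := fun j => by
    simp [(Polynomial.monic_X_sub_C (lam : ℂ)).natDegree_pow]
  have hmon := ((Polynomial.monic_X_sub_C (lam : ℂ)).pow q).coeff_natDegree
  rw [hdeg] at hmon
  rw [Finset.sum_eq_zero fun j hj => ?_, zero_add, Polynomial.coeff_C_mul, hmon, mul_one]
  rw [Polynomial.coeff_C_mul, Polynomial.coeff_eq_zero_of_natDegree_lt
    (by rw [hdeg]; exact Finset.mem_range.1 hj), mul_zero]

theorem isTaylorPoly_shift_pow_one (m : ℕ) (hm : 1 ≤ m) (lam : Circle) (a : ℕ) :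
    IsTaylorPoly ((shift m lam ^ a) (one m lam hm)) (taylorPow lam (m - 1) a) := by
  induction a with
  | zero =>
    have h0 : taylorPow lam (m - 1) 0 = 1 := by
      rw [taylorPow, Finset.sum_range_succ', Finset.sum_eq_zero fun j _ => by simp]
      simp
    rw [h0]
    refine ⟨?_, fun z hz => ?_⟩
    · rw [Polynomial.mem_degreeLT]
      exact lt_of_le_of_lt Polynomial.degree_one_le (by exact_mod_cast hm)
    · simp [one, H2.eval_const, H2.eval_zero z hz]
  | succ a ih =>
    have h := (shift_eq ih).2.2
    rw [coeff_taylorPow, X_mul_taylorPow, show m - 1 + 1 = m by omega, add_sub_cancel_right] at h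
    rw [pow_succ']
    exact h

/-- The values of the defect operators on the orbit of the constant function. -/
theorem fwdDiff_inner_shift_pow (m : ℕ) (hm : 1 ≤ m) (lam : Circle) (k : ℕ) :
    fwdDiff 1 (fun a : ℕ => inner ℂ ((shift m lam ^ a) ((shift m lam ^ k) (one m lam hm)))
      ((shift m lam ^ a) (one m lam hm))) = fun a : ℕ => ∑ n ∈ Finset.range (2 * (m - 1) + 1),
      (conj (lam : ℂ) ^ k * ((Nat.choose n (m - 1) *
        Nat.choose (k + (m - 1)) (2 * (m - 1) - n) : ℕ) : ℂ)) * (Nat.choose a n : ℂ) := by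
  ext a
  have hlam : conj (lam : ℂ) * (lam : ℂ) = 1 := by
    rw [mul_comm, Complex.mul_conj, Circle.normSq_coe]; simp
  have h1 : ∀ a : ℕ, (shift m lam ^ a) ((shift m lam ^ k) (one m lam hm)) =
      (shift m lam ^ (a + k)) (one m lam hm) := fun a => by rw [pow_add]; rfl
  have h2 := inner_shift (isTaylorPoly_shift_pow_one m hm lam (a + k))
    (isTaylorPoly_shift_pow_one m hm lam a)
  rw [coeff_taylorPow, coeff_taylorPow] at h2
  have h3 : ∀ a : ℕ, (shift m lam ^ (a + 1)) (one m lam hm) =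
      shift m lam ((shift m lam ^ a) (one m lam hm)) := fun a => by rw [pow_succ']; rfl
  simp only [fwdDiff, h1]
  rw [show a + 1 + k = (a + k) + 1 by ring, h3, h3, h2, add_sub_cancel_left]
  have h4 := congrArg (Nat.cast (R := ℂ)) (choose_mul_choose_eq_sum (m - 1) k a)
  push_cast at h4 ⊢
  simp only [mul_assoc (conj (lam : ℂ) ^ k)]
  rw [← Finset.mul_sum, ← h4]
  simp only [map_mul, map_pow, map_natCast, Complex.conj_conj]
  -- The powers of `λ` from the two top coefficients cancel except for `λ̄^k`, since `a` and `m-1`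
  -- each occur with both `λ` and `λ̄`.
  calc _ = (Nat.choose a (m - 1) : ℂ) * Nat.choose (a + k) (m - 1) * conj (lam : ℂ) ^ k *
        (conj (lam : ℂ) * lam) ^ (a + (m - 1)) := by ring
    _ = _ := by rw [hlam, one_pow]; ring

/-- After the first difference, `i` further ones shift the Newton coefficients by `i`. The `if`
extends the coefficients by zero beyond `2(m-1)`, where truncated subtraction would otherwise
produce `C(_, 0) = 1`. -/
theorem inner_defect_shift_pow (m : ℕ) (hm : 1 ≤ m) (lam : Circle) (i k a : ℕ) :
    inner ℂ ((shift m lam ^ a) ((shift m lam ^ k) (one m lam hm)))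
      (defect (shift m lam) (i + 1) ((shift m lam ^ a) (one m lam hm))) =
    ∑ n ∈ Finset.range (2 * (m - 1) + 1), (conj (lam : ℂ) ^ k * ((Nat.choose (n + i) (m - 1) *
        (if n + i ≤ 2 * (m - 1) then Nat.choose (k + (m - 1)) (2 * (m - 1) - (n + i)) else 0) : ℕ) :
          ℂ)) * (Nat.choose a n : ℂ) := by
  rw [← fwdDiff_iter_inner_pow, Function.iterate_succ_apply, fwdDiff_inner_shift_pow]
  rw [← fwdDiff_iter_newton (fun n => conj (lam : ℂ) ^ k * ((Nat.choose n (m - 1) *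
        (if n ≤ 2 * (m - 1) then Nat.choose (k + (m - 1)) (2 * (m - 1) - n) else 0) : ℕ) : ℂ))
    (2 * (m - 1) + 1) (fun n hn => by rw [if_neg (by omega)]; simp) i a]
  refine congrArg (fun g => (fwdDiff 1)^[i] g a) (funext fun x => ?_)
  refine Finset.sum_congr rfl fun n hn => ?_
  rw [if_pos (by have := Finset.mem_range.1 hn; omega)]

/-- At `a = 0` only the Newton term `n = 0` survives. With `i+1` in place of `i`, this is the
coefficient formula for the explicit distributions. -/
theorem inner_defect_succ_one (m : ℕ) (hm : 1 ≤ m) (lam : Circle) (i k : ℕ) (hi : i + 1 < 2 * m) :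
    inner ℂ ((shift m lam ^ k) (one m lam hm)) (defect (shift m lam) (i + 1) (one m lam hm)) =
      conj (lam : ℂ) ^ k * ((Nat.choose i (m - 1) *
        Nat.choose (k + (m - 1)) (2 * (m - 1) - i) : ℕ) : ℂ) := by
  have h := inner_defect_shift_pow m hm lam i k 0
  rw [Finset.sum_range_succ', Finset.sum_eq_zero fun n _ => by simp] at h
  simp only [zero_add, if_pos (show i ≤ 2 * (m - 1) by omega)] at h
  simpa using h

theorem norm_one (m : ℕ) (hm : 1 ≤ m) (lam : Circle) : ‖one m lam hm‖ = 1 := by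
  have h : ‖one m lam hm‖ ^ 2 = 1 := by
    rw [← inner_self_eq_norm_sq (𝕜 := ℂ), inner_def]
    simp [one, H2.const]
  exact (pow_eq_one_iff_of_nonneg (norm_nonneg _) two_ne_zero).1 h

theorem eval_one (m : ℕ) (hm : 1 ≤ m) (lam : Circle) (z : ℂ) : eval (one m lam hm) z = 1 :=
  H2.eval_const 1 z

theorem eval_shift_pow_one (m : ℕ) (hm : 1 ≤ m) (lam : Circle) (a : ℕ) (z : ℂ) (hz : ‖z‖ < 1) :
    eval ((shift m lam ^ a) (one m lam hm)) z = z ^ a := by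
  induction a with
  | zero => simp [eval_one]
  | succ a ih =>
    rw [pow_succ']
    change eval (shift m lam ((shift m lam ^ a) (one m lam hm))) z = _
    rw [eval_shift m lam _ z hz, ih, pow_succ']

/-- The pair storing `1` has second component `0`, and `zH²` is orthogonal to constants; hence `μ₀`
is normalized Lebesgue measure. -/
theorem inner_shift_pow_one (m : ℕ) (hm : 1 ≤ m) (lam : Circle) (k : ℕ) :
    inner ℂ ((shift m lam ^ k) (one m lam hm)) (one m lam hm) = if k = 0 then 1 else 0 := by
  rcases k with _ | k
  · rw [if_pos rfl]
    refine (inner_self_eq_norm_sq_to_K (𝕜 := ℂ) (one m lam hm)).trans ?_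
    rw [norm_one]
    simp
  · rw [pow_succ']
    change inner ℂ (shift m lam ((shift m lam ^ k) (one m lam hm))) (one m lam hm) = _
    rw [inner_def, (shift_eq (isTaylorPoly_shift_pow_one m hm lam k)).1]
    have h : inner ℂ (H2.mulZ ((shift m lam ^ k) (one m lam hm) : WithLp 2 (H2 × H2)).fst)
        (H2.const 1) = 0 := by
      have h0 := H2.inner_mulZ_add_const
        ((shift m lam ^ k) (one m lam hm) : WithLp 2 (H2 × H2)).fst 0 0 1
      have h1 : H2.mulZ 0 = 0 := map_zero H2.mulZL
      simpa only [H2.const_zero, h1, add_zero, zero_add, inner_zero_right, map_zero,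
        zero_mul] using h0
    change inner ℂ (H2.mulZ _) (H2.const 1) + inner ℂ _ (0 : H2) = _
    rw [h, inner_zero_right, add_zero, if_neg k.succ_ne_zero]

/-! ### Cyclicity -/

/-- The element `(z - λ)^m h` of the local Dirichlet space. -/
def ofHardy (m : ℕ) (lam : Circle) (h : H2) : LocalDirichlet m lam :=
  ⟨WithLp.toLp 2 (((H2.mulZL - (lam : ℂ) • ContinuousLinearMap.id ℂ H2) ^ m) h, h), 0,
    Submodule.zero_mem _, fun z hz => by
      refine (H2.eval_mulZL_sub_pow _ _ _ z hz).trans ?_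
      rw [Polynomial.eval_zero, zero_add]
      rfl⟩

theorem eval_ofHardy (m : ℕ) (lam : Circle) (h : H2) (z : ℂ) (hz : ‖z‖ < 1) :
    eval (ofHardy m lam h) z = (z - lam) ^ m * h.eval z :=
  H2.eval_mulZL_sub_pow _ _ _ z hz

theorem continuous_ofHardy (m : ℕ) (lam : Circle) : Continuous (ofHardy m lam) := by
  refine Continuous.subtype_mk ?_ _
  refine (WithLp.prod_continuous_toLp 2 H2 H2).comp (Continuous.prodMk ?_ continuous_id)
  exact ContinuousLinearMap.continuous _

theorem eval_aeval_shift (m : ℕ) (hm : 1 ≤ m) (lam : Circle) (P : Polynomial ℂ) (z : ℂ)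
    (hz : ‖z‖ < 1) :
    eval (Polynomial.aeval (shift m lam) P (one m lam hm)) z = P.eval z := by
  induction P using Polynomial.induction_on' with
  | add p q hp hq =>
    rw [map_add, add_apply, eval_add _ _ z hz, hp, hq, Polynomial.eval_add]
  | monomial n a =>
    rw [Polynomial.aeval_monomial, Polynomial.eval_monomial, Algebra.algebraMap_eq_smul_one,
      smul_mul_assoc, one_mul, smul_apply, eval_smul _ _ z hz,
      eval_shift_pow_one m hm lam n z hz]

theorem aeval_shift_mem_span (m : ℕ) (hm : 1 ≤ m) (lam : Circle) (P : Polynomial ℂ) :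
    Polynomial.aeval (shift m lam) P (one m lam hm) ∈
      Submodule.span ℂ (Set.range fun k : ℕ => (shift m lam ^ k) (one m lam hm)) := by
  induction P using Polynomial.induction_on' with
  | add p q hp hq =>
    rw [map_add, add_apply]
    exact Submodule.add_mem _ hp hq
  | monomial n a =>
    rw [Polynomial.aeval_monomial, Algebra.algebraMap_eq_smul_one,
      smul_mul_assoc, one_mul, smul_apply]
    exact Submodule.smul_mem _ _ (Submodule.subset_span ⟨n, rfl⟩)

/-- In `f = p + (z-λ)^m h` the first summand is a polynomial. Since `h ↦ (z-λ)^m h` is continuous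
from `H²` into the space, Taylor sections of `h` make the second a limit of polynomials. -/
theorem isCyclicVector_one (m : ℕ) (hm : 1 ≤ m) (lam : Circle) :
    IsCyclicVector (shift m lam) (one m lam hm) := by
  rw [IsCyclicVector, eq_top_iff]
  intro F _
  set V := Submodule.span ℂ (Set.range fun k : ℕ => (shift m lam ^ k) (one m lam hm))
  obtain ⟨p, hp, hF⟩ := exists_isTaylorPoly F
  have h1 : F = Polynomial.aeval (shift m lam) p (one m lam hm) +
      ofHardy m lam (F : WithLp 2 (H2 × H2)).snd := by
    apply eval_injective
    intro z hz
    rw [eval_add _ _ z hz, eval_aeval_shift m hm lam p z hz, eval_ofHardy m lam _ z hz]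
    exact hF z hz
  rw [h1]
  refine Submodule.add_mem _ (V.le_topologicalClosure (aeval_shift_mem_span m hm lam p)) ?_
  set h := (F : WithLp 2 (H2 × H2)).snd
  have h2 := ((continuous_ofHardy m lam).tendsto h).comp (lp.hasSum_single (by norm_num) h)
  refine V.isClosed_topologicalClosure.mem_of_tendsto h2 (Filter.Eventually.of_forall fun s => ?_)
  refine V.le_topologicalClosure ?_
  convert aeval_shift_mem_span m hm lam ((Polynomial.X - Polynomial.C (lam : ℂ)) ^ m *
    ∑ n ∈ s, Polynomial.C (h n) * Polynomial.X ^ n)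
  apply eval_injective
  intro z hz
  rw [eval_aeval_shift m hm lam _ z hz, Polynomial.eval_mul, ← H2.eval_sum_single h s z hz]
  simpa using eval_ofHardy m lam _ z hz

/-! ### Strict isometry and growth of the orbit -/

/-- In the Newton expansion every index `n + 2m-1` exceeds `2(m-1)`, so all terms are zero. This
handles exponents `b ≥ a`; Hermitian symmetry of the defects gives the rest. -/
theorem defect_shift_eq_zero (m : ℕ) (hm : 1 ≤ m) (lam : Circle) :
    defect (shift m lam) (2 * m) = 0 := by
  have key : ∀ a k : ℕ, inner ℂ ((shift m lam ^ (a + k)) (one m lam hm))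
      (defect (shift m lam) (2 * m) ((shift m lam ^ a) (one m lam hm))) = 0 := by
    intro a k
    have h := inner_defect_shift_pow m hm lam (2 * m - 1) k a
    rw [show 2 * m - 1 + 1 = 2 * m by omega, Finset.sum_eq_zero fun n _ => by
      rw [if_neg (by omega)]; simp] at h
    rw [pow_add]
    exact h
  refine eq_zero_of_isCyclicVector (isCyclicVector_one m hm lam) fun a b => ?_
  rcases le_total a b with h | h
  · obtain ⟨k, rfl⟩ := Nat.exists_eq_add_of_le h
    exact key a k
  · obtain ⟨k, rfl⟩ := Nat.exists_eq_add_of_le h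
    rw [inner_defect_comm, key b k, map_zero]

theorem isStrictIsometry_shift (m : ℕ) (hm : 1 ≤ m) (lam : Circle) :
    IsStrictIsometry (shift m lam) (2 * m) := by
  -- The witness against a smaller order is `⟨Δ⁽²ᵐ⁻¹⁾ 1, 1⟩ = C(2m-2, m-1) ≠ 0`.
  refine ⟨defect_shift_eq_zero m hm lam, fun h => ?_⟩
  have h1 := inner_defect_succ_one m hm lam (2 * m - 2) 0 (by omega)
  rw [show 2 * m - 2 + 1 = 2 * m - 1 by omega, h, show 2 * (m - 1) - (2 * m - 2) = 0 by omega] at h1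
  have h2 : Nat.choose (2 * m - 2) (m - 1) ≠ 0 := (Nat.choose_pos (by omega)).ne'
  simp at h1
  exact h2 (by exact_mod_cast h1.symm)

/-- The orbit of the constant function has polynomial growth. -/
theorem norm_shift_pow_one_le (m : ℕ) (hm : 1 ≤ m) (lam : Circle) (a : ℕ) :
    ‖(shift m lam ^ a) (one m lam hm)‖ ≤ (1 + a : ℝ) ^ (2 * (m - 1) + 1) := by
  -- The squared norm grows at step `a` by `C(a, m-1)² ≤ a^(2(m-1))`, so summation costs one more
  -- power. As the bound is at least `1`, it may be squared at the end, giving a crude bound for the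
  -- norm itself.
  have h : ‖(shift m lam ^ a) (one m lam hm)‖ ^ 2 ≤ (1 + a : ℝ) ^ (2 * (m - 1) + 1) := by
    induction a with
    | zero =>
      change ‖one m lam hm‖ ^ 2 ≤ _
      rw [norm_one]
      simp
    | succ a ih =>
      have hT := isTaylorPoly_shift_pow_one m hm lam a
      have h1 := congrArg Complex.re (inner_shift hT hT)
      rw [← Complex.normSq_eq_conj_mul_self, Complex.add_re, Complex.ofReal_re, coeff_taylorPow,
        Complex.normSq_eq_norm_sq] at h1
      simp only [norm_mul, norm_pow, Complex.norm_natCast, Circle.norm_coe, RCLike.norm_conj,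
        one_pow, mul_one] at h1
      have h2 : ‖(shift m lam ^ (a + 1)) (one m lam hm)‖ ^ 2 =
          ‖(shift m lam ^ a) (one m lam hm)‖ ^ 2 + (Nat.choose a (m - 1) : ℝ) ^ 2 := by
        rw [← inner_self_eq_norm_sq (𝕜 := ℂ), ← inner_self_eq_norm_sq (𝕜 := ℂ), pow_succ']
        exact h1
      have h3 : (Nat.choose a (m - 1) : ℝ) ≤ (a : ℝ) ^ (m - 1) := by
        exact_mod_cast Nat.choose_le_pow _ _
      rw [h2, Nat.cast_succ]
      calc _ ≤ (1 + a : ℝ) ^ (2 * (m - 1) + 1) + ((a : ℝ) ^ (m - 1)) ^ 2 := by gcongr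
        _ ≤ (1 + a : ℝ) ^ (2 * (m - 1) + 1) + (1 + a : ℝ) ^ (2 * (m - 1)) := by
          rw [← pow_mul, mul_comm (m - 1)]
          gcongr
          linarith
        _ = (1 + a : ℝ) ^ (2 * (m - 1)) * (1 + (a + 1)) := by ring
        _ ≤ (1 + (a + 1) : ℝ) ^ (2 * (m - 1)) * (1 + (a + 1)) := by gcongr; linarith
        _ = _ := (pow_succ _ _).symm
  have h1 : (1 : ℝ) ≤ (1 + a : ℝ) ^ (2 * (m - 1) + 1) :=
    one_le_pow₀ (by linarith [Nat.cast_nonneg (α := ℝ) a])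
  exact le_of_sq_le_sq (h.trans (le_self_pow₀ h1 two_ne_zero)) (by positivity)

end LocalDirichlet

/-! ### Power series with rapidly decreasing coefficients -/

/-- The sequence `a` decays faster than every power. -/
def RapidDecay (a : ℕ → ℂ) : Prop := ∀ N : ℕ, Summable fun n : ℕ => ‖a n‖ * (1 + n : ℝ) ^ N

theorem RapidDecay.summable_norm {a : ℕ → ℂ} (ha : RapidDecay a) : Summable fun n => ‖a n‖ := by
  simpa using ha 0

theorem AnalyticTest.rapidDecay (f : AnalyticTest) :
    RapidDecay fun n => (f : TestFun).coeff n := by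
  intro N
  have h := (TestFun.summable_coeff (f : TestFun) N)
    |>.comp_injective (i := fun n : ℕ => (n : ℤ)) Nat.cast_injective
  simpa [Function.comp_def] using h

/-- The function `z ↦ ∑ aₙ zⁿ`. -/
def powerSum (a : ℕ → ℂ) (z : ℂ) : ℂ := ∑' n : ℕ, a n * z ^ n

theorem AnalyticTest.extend_eq_powerSum (f : AnalyticTest) :
    f.extend = powerSum fun n => (f : TestFun).coeff n := by
  ext z
  have h : ∀ k : ℕ, (f : TestFun).coeff (-((k : ℤ) + 1)) = 0 := fun k => f.2 _ (by omega)
  simp only [AnalyticTest.extend, poisson, powerSum, h, zero_mul, tsum_zero, add_zero]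

theorem norm_mul_pow_le {z : ℂ} (hz : ‖z‖ ≤ 1) (c : ℂ) (n : ℕ) : ‖c * z ^ n‖ ≤ ‖c‖ := by
  rw [norm_mul, norm_pow]
  exact mul_le_of_le_one_right (norm_nonneg _) (pow_le_one₀ (norm_nonneg _) hz)

theorem RapidDecay.summable_norm_mul_pow {a : ℕ → ℂ} (ha : RapidDecay a) {z : ℂ} (hz : ‖z‖ ≤ 1) :
    Summable fun n => ‖a n * z ^ n‖ :=
  Summable.of_nonneg_of_le (fun _ => norm_nonneg _) (fun n => norm_mul_pow_le hz (a n) n)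
    ha.summable_norm

theorem RapidDecay.hasSum_powerSum {a : ℕ → ℂ} (ha : RapidDecay a) {z : ℂ} (hz : ‖z‖ ≤ 1) :
    HasSum (fun n => a n * z ^ n) (powerSum a z) :=
  (ha.summable_norm_mul_pow hz).of_norm.hasSum

/-- These are the Taylor coefficients of the `i`-th derivative; the falling factorial costs `i`
powers, paid by decay of order `N+i`. -/
theorem RapidDecay.shift {a : ℕ → ℂ} (ha : RapidDecay a) (i : ℕ) :
    RapidDecay fun n => ((n + i).descFactorial i : ℂ) * a (n + i) := by
  intro N
  have h := (summable_nat_add_iff i).2 (ha (N + i))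
  refine Summable.of_nonneg_of_le (fun n => by positivity) (fun n => ?_) h
  rw [norm_mul, Complex.norm_natCast]
  have h1 : ((n + i).descFactorial i : ℝ) ≤ (1 + (n + i : ℕ) : ℝ) ^ i := by
    have h2 := Nat.descFactorial_le_pow (n + i) i
    calc ((n + i).descFactorial i : ℝ) ≤ ((n + i : ℕ) : ℝ) ^ i := by exact_mod_cast h2
      _ ≤ _ := by gcongr; linarith
  calc ((n + i).descFactorial i : ℝ) * ‖a (n + i)‖ * (1 + n) ^ N
      ≤ (1 + (n + i : ℕ) : ℝ) ^ i * ‖a (n + i)‖ * (1 + (n + i : ℕ)) ^ N := by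
        gcongr
        omega
    _ = _ := by rw [pow_add]; ring

/-- On the whole unit disc the differentiated terms are dominated by `‖a n‖ (1+n)`, which is
summable. -/
theorem RapidDecay.hasDerivAt_powerSum {a : ℕ → ℂ} (ha : RapidDecay a) {z : ℂ} (hz : ‖z‖ < 1) :
    HasDerivAt (powerSum a) (powerSum (fun n => ((n : ℂ) + 1) * a (n + 1)) z) z := by
  have hu : Summable fun n : ℕ => ‖a n‖ * (1 + n : ℝ) ^ 1 := ha 1
  have hbd : ∀ (n : ℕ) (y : ℂ), y ∈ Metric.ball (0 : ℂ) 1 →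
      ‖a n * ((n : ℂ) * y ^ (n - 1))‖ ≤ ‖a n‖ * (1 + n : ℝ) ^ 1 := by
    intro n y hy
    have hy' : ‖y‖ ≤ 1 := (mem_ball_zero_iff.1 hy).le
    rw [norm_mul]
    gcongr
    refine (norm_mul_pow_le hy' _ _).trans ?_
    rw [Complex.norm_natCast, pow_one]
    linarith
  have hz' : z ∈ Metric.ball (0 : ℂ) 1 := mem_ball_zero_iff.2 hz
  have h := hasDerivAt_tsum_of_isPreconnected (g := fun (n : ℕ) (y : ℂ) => a n * y ^ n)
    (g' := fun n y => a n * ((n : ℂ) * y ^ (n - 1))) hu Metric.isOpen_ball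
    (convex_ball (0 : ℂ) 1).isPreconnected
    (fun n y _ => (hasDerivAt_pow n y).const_mul (a n)) hbd hz'
    (ha.summable_norm_mul_pow hz.le).of_norm hz'
  rw [(Summable.of_norm_bounded hu fun n => hbd n z hz').tsum_eq_zero_add] at h
  convert! h using 1
  simp only [powerSum, Nat.cast_zero, zero_mul, mul_zero, zero_add, Nat.add_sub_cancel]
  refine tsum_congr fun n => ?_
  push_cast
  ring

theorem RapidDecay.iteratedDeriv_powerSum {a : ℕ → ℂ} (ha : RapidDecay a) (i : ℕ) {z : ℂ}
    (hz : ‖z‖ < 1) : iteratedDeriv i (powerSum a) z =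
      powerSum (fun n => ((n + i).descFactorial i : ℂ) * a (n + i)) z := by
  induction i generalizing z with
  | zero => simp
  | succ i ih =>
    have h : iteratedDeriv i (powerSum a) =ᶠ[𝓝 z]
        powerSum (fun n => ((n + i).descFactorial i : ℂ) * a (n + i)) := by
      filter_upwards [Metric.isOpen_ball.mem_nhds (mem_ball_zero_iff.2 hz)] with y hy
      exact ih (mem_ball_zero_iff.1 hy)
    rw [iteratedDeriv_succ, h.deriv_eq, ((ha.shift i).hasDerivAt_powerSum hz).deriv]
    congr 1
    ext n
    rw [show n + (i + 1) = n + 1 + i by ring, Nat.descFactorial_succ,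
      show n + 1 + i - i = n + 1 by omega]
    push_cast
    ring

/-! ### Poisson extensions -/

/-- The harmonic monomial `zᵏ` for `k ≥ 0`, `z̄^{|k|}` for `k < 0`. -/
def harmonicMonomial (k : ℤ) (z : ℂ) : ℂ := z ^ k.toNat * conj z ^ (-k).toNat

theorem norm_harmonicMonomial (k : ℤ) (z : ℂ) : ‖harmonicMonomial k z‖ = ‖z‖ ^ k.natAbs := by
  rw [harmonicMonomial, norm_mul, norm_pow, norm_pow, RCLike.norm_conj, ← pow_add]
  congr 1
  omega

theorem summable_mul_pow_natAbs {c : ℤ → ℂ} {N : ℕ} {C : ℝ}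
    (hc : ∀ k, ‖c k‖ ≤ C * (1 + |(k : ℝ)|) ^ N) {r : ℝ} (hr0 : 0 < r) (hr1 : r < 1) :
    Summable fun k : ℤ => ‖c k‖ * r ^ k.natAbs := by
  have h : Summable fun n : ℕ => (1 + n : ℝ) ^ N * r ^ n := by
    have h0 : Summable fun n : ℕ => (n : ℝ) ^ N * r ^ n :=
      summable_pow_mul_geometric_of_norm_lt_one N (by rwa [Real.norm_of_nonneg hr0.le])
    have h1 := (summable_nat_add_iff (f := fun n : ℕ => (n : ℝ) ^ N * r ^ n) 1).2 h0
    refine (h1.mul_left r⁻¹).congr fun n => ?_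
    push_cast
    rw [pow_succ, add_comm (n : ℝ) 1]
    field_simp
  refine Summable.of_nonneg_of_le (fun k => by positivity) (fun k => ?_)
    (f := fun k : ℤ => C * ((1 + |(k : ℝ)|) ^ N * r ^ k.natAbs)) ?_
  · rw [← mul_assoc]
    gcongr
    exact hc k
  · refine Summable.mul_left C (Summable.of_nat_of_neg ?_ ?_) <;> simpa using h

theorem hasSum_poisson {c : ℤ → ℂ} {N : ℕ} {C : ℝ}
    (hc : ∀ k, ‖c k‖ ≤ C * (1 + |(k : ℝ)|) ^ N) {r : ℝ} (hr0 : 0 < r) (hr1 : r < 1) {z : ℂ}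
    (hz : ‖z‖ ≤ r) : HasSum (fun k : ℤ => c k * harmonicMonomial k z) (poisson c z) := by
  have hs : Summable fun k : ℤ => c k * harmonicMonomial k z := by
    refine Summable.of_norm_bounded (summable_mul_pow_natAbs hc hr0 hr1) fun k => ?_
    rw [norm_mul, norm_harmonicMonomial]
    gcongr
  have h1 := (hs.comp_injective (i := fun n : ℕ => (n : ℤ)) Nat.cast_injective).hasSum
  have h2 := (hs.comp_injective (i := fun n : ℕ => -((n : ℤ) + 1))
    (fun a b hab => by simpa using hab)).hasSum
  have h3 := HasSum.of_nat_of_neg_add_one (f := fun k : ℤ => c k * harmonicMonomial k z) h1 h2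
  convert h3 using 1
  rw [poisson]
  congr 1
  · refine tsum_congr fun n => ?_
    simp [harmonicMonomial]
  · refine tsum_congr fun n => ?_
    have e1 : (-((n : ℤ) + 1)).toNat = 0 := by omega
    have e2 : (-(-((n : ℤ) + 1))).toNat = n + 1 := by omega
    simp only [Function.comp_apply, harmonicMonomial, e1, e2, pow_zero, one_mul]

/-! ### Termwise integration -/

theorem integrable_moment {X : Type*} [MeasurableSpace X] (ν : Measure X) [IsFiniteMeasure ν]
    {ζ : X → ℂ} (hζ : Measurable ζ) {w : X → ℝ} (hw : Measurable w)
    (hb : ∀ᵐ x ∂ν, ‖ζ x‖ ≤ 1 ∧ |w x| ≤ 1) (p q : ℕ) :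
    Integrable (fun x => ζ x ^ p * conj (ζ x) ^ q * (w x : ℂ)) ν := by
  refine Integrable.of_bound (C := 1) ?_ ?_
  · have h1 : Measurable fun x => conj (ζ x) := Complex.continuous_conj.measurable.comp hζ
    exact (((hζ.pow_const p).mul (h1.pow_const q)).mul
      (Complex.measurable_ofReal.comp hw)).aestronglyMeasurable
  · filter_upwards [hb] with x hx
    rw [norm_mul, norm_mul, norm_pow, norm_pow, RCLike.norm_conj, Complex.norm_real,
      Real.norm_eq_abs]
    exact mul_le_one₀ (mul_le_one₀ (pow_le_one₀ (norm_nonneg _) hx.1) (by positivity)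
      (pow_le_one₀ (norm_nonneg _) hx.1)) (abs_nonneg _) hx.2

theorem hasSum_mul_mul_of_summable_norm {ι κ η : Type*} {a : ι → ℂ} {b : κ → ℂ} {d : η → ℂ}
    {A B D : ℂ} (ha : HasSum a A) (hb : HasSum b B) (hd : HasSum d D)
    (sa : Summable fun x => ‖a x‖) (sb : Summable fun x => ‖b x‖) (sd : Summable fun x => ‖d x‖) :
    HasSum (fun p : (ι × κ) × η => a p.1.1 * b p.1.2 * d p.2) (A * B * D) := by
  have s1 : Summable fun p : ι × κ => ‖a p.1 * b p.2‖ := sa.mul_norm sb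
  have h1 : HasSum (fun p : ι × κ => a p.1 * b p.2) (A * B) := ha.mul hb s1.of_norm
  have s2 : Summable fun p : (ι × κ) × η => ‖a p.1.1 * b p.1.2 * d p.2‖ :=
    Summable.mul_norm (f := fun p : ι × κ => a p.1 * b p.2) s1 sd
  exact HasSum.mul (f := fun p : ι × κ => a p.1 * b p.2) h1 hd s2.of_norm

/-- Termwise integration of `|g|² P_c` against a measure whose mixed moments vanish off the
diagonal. -/
theorem hasSum_integral_normSq_mul_poisson {X : Type*} [MeasurableSpace X] (ν : Measure X)
    [IsFiniteMeasure ν] {ζ : X → ℂ} (hζ : Measurable ζ) {w : X → ℝ} (hw : Measurable w)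
    {r : ℝ} (hr0 : 0 < r) (hr1 : r < 1) (hb : ∀ᵐ x ∂ν, ‖ζ x‖ ≤ r ∧ |w x| ≤ 1)
    {g : ℕ → ℂ} (hg : RapidDecay g) {c : ℤ → ℂ} {N : ℕ} {C : ℝ}
    (hc : ∀ k, ‖c k‖ ≤ C * (1 + |(k : ℝ)|) ^ N) {M : ℕ → ℂ}
    (hM : ∀ p q : ℕ, ∫ x, ζ x ^ p * conj (ζ x) ^ q * (w x : ℂ) ∂ν = if p = q then M p else 0) :
    HasSum (fun p : ℕ × ℕ => g p.1 * conj (g p.2) * c ((p.2 : ℤ) - p.1) * M (max p.1 p.2))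
      (∫ x, ((‖powerSum g (ζ x)‖ ^ 2 : ℝ) : ℂ) * poisson c (ζ x) * (w x : ℂ) ∂ν) := by
  have hb1 : ∀ᵐ x ∂ν, ‖ζ x‖ ≤ 1 ∧ |w x| ≤ 1 := hb.mono fun x hx => ⟨hx.1.trans hr1.le, hx.2⟩
  let F : (ℕ × ℕ) × ℤ → X → ℂ := fun p x =>
    ((g p.1.1 * ζ x ^ p.1.1) * conj (g p.1.2 * ζ x ^ p.1.2)) *
      (c p.2 * harmonicMonomial p.2 (ζ x)) * (w x : ℂ)
  have hF : ∀ p : (ℕ × ℕ) × ℤ, F p = fun x => (g p.1.1 * conj (g p.1.2) * c p.2) *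
      (ζ x ^ (p.1.1 + p.2.toNat) * conj (ζ x) ^ (p.1.2 + (-p.2).toNat) * (w x : ℂ)) := by
    intro p
    ext x
    simp only [F, harmonicMonomial, map_mul, map_pow, pow_add]
    ring
  have hint : ∀ p, Integrable (F p) ν := fun p => by
    rw [hF p]
    exact (integrable_moment ν hζ hw hb1 _ _).const_mul _
  have hbd : ∀ p : (ℕ × ℕ) × ℤ, ∀ᵐ x ∂ν, ‖F p x‖ ≤
      (‖g p.1.1‖ * ‖g p.1.2‖) * (‖c p.2‖ * r ^ p.2.natAbs) := by
    intro p
    filter_upwards [hb] with x hx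
    have hx1 := hx.1.trans hr1.le
    simp only [F]
    rw [norm_mul, norm_mul, norm_mul _ (conj _), RCLike.norm_conj, Complex.norm_real,
      Real.norm_eq_abs, norm_mul (c _), norm_harmonicMonomial]
    calc _ ≤ ((‖g p.1.1‖ * ‖g p.1.2‖) * (‖c p.2‖ * r ^ p.2.natAbs)) * 1 := by
          gcongr
          · exact norm_mul_pow_le hx1 _ _
          · exact norm_mul_pow_le hx1 _ _
          · exact hx.1
          · exact hx.2
      _ = _ := mul_one _
  have hgg : Summable fun p : ℕ × ℕ => ‖g p.1‖ * ‖g p.2‖ :=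
    hg.summable_norm.mul_of_nonneg hg.summable_norm (fun _ => norm_nonneg _) fun _ => norm_nonneg _
  have hsum : Summable fun p : (ℕ × ℕ) × ℤ =>
      (‖g p.1.1‖ * ‖g p.1.2‖) * (‖c p.2‖ * r ^ p.2.natAbs) :=
    hgg.mul_of_nonneg (summable_mul_pow_natAbs hc hr0 hr1) (fun _ => by positivity)
      fun _ => by positivity
  have h1 := hasSum_integral_of_summable_integral_norm hint (by
    refine Summable.of_nonneg_of_le (fun p => integral_nonneg fun x => norm_nonneg _) (fun p => ?_)
      (hsum.mul_right (ν.real Set.univ))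
    have := integral_mono_ae (hint p).norm (integrable_const _) (hbd p)
    rwa [integral_const, smul_eq_mul, mul_comm] at this)
  have h2 : ∫ x, ∑' p, F p x ∂ν =
      ∫ x, ((‖powerSum g (ζ x)‖ ^ 2 : ℝ) : ℂ) * poisson c (ζ x) * (w x : ℂ) ∂ν := by
    refine integral_congr_ae ?_
    filter_upwards [hb] with x hx
    have hx1 := hx.1.trans hr1.le
    have s1 := hg.summable_norm_mul_pow hx1
    have s2 : Summable fun n => ‖conj (g n * ζ x ^ n)‖ := by simpa only [RCLike.norm_conj] using s1
    have hP := hasSum_poisson hc hr0 hr1 hx.1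
    have s3 : Summable fun k : ℤ => ‖c k * harmonicMonomial k (ζ x)‖ := by
      refine Summable.of_nonneg_of_le (fun _ => norm_nonneg _) (fun k => ?_)
        (summable_mul_pow_natAbs hc hr0 hr1)
      rw [norm_mul, norm_harmonicMonomial]
      gcongr
      exact hx.1
    have q1 := hg.hasSum_powerSum hx1
    have q2 : HasSum (fun n => conj (g n * ζ x ^ n)) (conj (powerSum g (ζ x))) :=
      q1.map (starRingEnd ℂ) Complex.continuous_conj
    have q5 := (hasSum_mul_mul_of_summable_norm q1 q2 hP s1 s2 s3).mul_right (w x : ℂ)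
    change ∑' p, F p x = _
    rw [q5.tsum_eq, Complex.mul_conj, Complex.normSq_eq_norm_sq]
  rw [h2] at h1
  -- For the term indexed by `((a,b),k)`, a nonzero moment forces `a + k⁺ = b + k⁻`, i.e. `k = b -
  -- a`. The triple series is supported on the image of this map and collapses to a double one.
  have hinj : Function.Injective fun p : ℕ × ℕ => ((p, (p.2 : ℤ) - p.1) : (ℕ × ℕ) × ℤ) :=
    fun p q h => (Prod.ext_iff.1 h).1
  have h3 : ∀ p : (ℕ × ℕ) × ℤ, ∫ x, F p x ∂ν = (g p.1.1 * conj (g p.1.2) * c p.2) *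
      if p.1.1 + p.2.toNat = p.1.2 + (-p.2).toNat then M (p.1.1 + p.2.toNat) else 0 := by
    intro p
    rw [hF p, integral_const_mul, hM]
  simp only [h3] at h1
  rw [← hinj.hasSum_iff] at h1
  · refine (congrArg (fun G => HasSum G _) (funext fun p => ?_)).mpr h1
    simp only [Function.comp_apply]
    -- The common exponent is `a + (b-a)⁺ = max(a,b)`.
    rw [if_pos (by omega), show p.1 + ((p.2 : ℤ) - p.1).toNat = max p.1 p.2 by omega]
  · rintro ⟨⟨a, b⟩, k⟩ hk
    dsimp only
    rw [if_neg, mul_zero]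
    intro h
    exact hk ⟨(a, b), by simp only [Prod.mk.injEq, true_and]; omega⟩

/-! ### Moments -/

theorem integral_exp_zpow (a : ℝ) (n : ℤ) :
    ∫ t in a..a + 2 * Real.pi, ((Circle.exp t ^ n : Circle) : ℂ) =
      if n = 0 then (2 * Real.pi : ℂ) else 0 := by
  split_ifs with hn
  · subst hn
    simp
  · have hne : (n : ℂ) * Complex.I ≠ 0 :=
      mul_ne_zero (by exact_mod_cast hn) Complex.I_ne_zero
    have h2 := intervalIntegral.integral_eq_sub_of_hasDerivAt (a := a) (b := a + 2 * Real.pi)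
      (fun t _ => hasDerivAt_exp_zpow n t)
      ((continuous_const.mul (contDiff_exp_zpow n).continuous).intervalIntegrable _ _)
    rw [intervalIntegral.integral_const_mul] at h2
    simp only [Circle.exp_add, Circle.exp_two_pi, mul_one, sub_self] at h2
    exact (mul_eq_zero.1 h2).resolve_left hne

theorem polar_pow_mul_conj_pow (ρ t : ℝ) (p q : ℕ) :
    ((ρ : ℂ) * (Circle.exp t : ℂ)) ^ p * conj ((ρ : ℂ) * (Circle.exp t : ℂ)) ^ q =
      (ρ : ℂ) ^ (p + q) * ((Circle.exp t ^ ((p : ℤ) - q) : Circle) : ℂ) := by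
  rw [zpow_sub, zpow_natCast, zpow_natCast, map_mul, Complex.conj_ofReal, ← Circle.coe_inv_eq_conj,
    Circle.coe_mul, Circle.coe_inv, Circle.coe_inv, Circle.coe_pow, Circle.coe_pow, mul_pow, mul_pow,
    pow_add, inv_pow]
  ring

theorem integral_circle_moment (r : ℝ) (p q : ℕ) :
    ∫ t in Set.Ioc (0 : ℝ) (2 * Real.pi), ((r : ℂ) * (Circle.exp t : ℂ)) ^ p *
      conj ((r : ℂ) * (Circle.exp t : ℂ)) ^ q * ((1 : ℝ) : ℂ) =
      if p = q then 2 * Real.pi * (r : ℂ) ^ (2 * p) else 0 := by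
  have h := integral_exp_zpow 0 ((p : ℤ) - q)
  rw [zero_add, intervalIntegral.integral_of_le (by positivity)] at h
  simp only [polar_pow_mul_conj_pow, Complex.ofReal_one, mul_one]
  rw [integral_const_mul, h]
  split_ifs with h1 h2 h2
  · subst h2; ring
  · omega
  · omega
  · simp

/-- The radial integrals `∫₀ʳ ρ^{2p+1} (1 - ρ²)ⁱ dρ`. -/
def radialIntegral (i p : ℕ) (r : ℝ) : ℝ := ∫ ρ in (0 : ℝ)..r, ρ ^ (2 * p + 1) * (1 - ρ ^ 2) ^ i

/-- In polar coordinates the angular integral forces `p = q`, and the Jacobian `ρ` raises the radial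
exponent from `2p` to `2p+1`. -/
theorem integral_ball_moment (i : ℕ) {r : ℝ} (hr : 0 < r) (p q : ℕ) :
    ∫ z in Metric.ball (0 : ℂ) r, z ^ p * conj z ^ q * (((1 - ‖z‖ ^ 2) ^ i : ℝ) : ℂ) =
      if p = q then 2 * Real.pi * (radialIntegral i p r : ℂ) else 0 := by
  rw [← integral_indicator measurableSet_ball, ← Complex.integral_comp_polarCoord_symm]
  have h1 : ∀ x : ℝ × ℝ, Complex.polarCoord.symm x = (x.1 : ℂ) * (Circle.exp x.2 : ℂ) := fun x => by
    rw [Complex.polarCoord_symm_apply, Circle.coe_exp, Complex.exp_mul_I, Complex.ofReal_cos,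
      Complex.ofReal_sin]
  have h2 : ∫ x in polarCoord.target, x.1 • (Metric.ball (0 : ℂ) r).indicator
      (fun z => z ^ p * conj z ^ q * (((1 - ‖z‖ ^ 2) ^ i : ℝ) : ℂ)) (Complex.polarCoord.symm x) =
      ∫ x in polarCoord.target, (Set.Iio r ×ˢ (Set.univ : Set ℝ)).indicator (fun x : ℝ × ℝ =>
        ((x.1 ^ (p + q + 1) * (1 - x.1 ^ 2) ^ i : ℝ) : ℂ) *
          ((Circle.exp x.2 ^ ((p : ℤ) - q) : Circle) : ℂ)) x := by
    refine setIntegral_congr_fun (polarCoord.open_target.measurableSet) fun x hx => ?_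
    rw [polarCoord_target] at hx
    have hx0 : 0 < x.1 := hx.1
    have hn : ‖(x.1 : ℂ) * (Circle.exp x.2 : ℂ)‖ = x.1 := by
      rw [norm_mul, Circle.norm_coe, mul_one, Complex.norm_real, Real.norm_of_nonneg hx0.le]
    rw [h1]
    by_cases hxr : x.1 < r
    · rw [Set.indicator_of_mem (by rw [mem_ball_zero_iff, hn]; exact hxr),
        Set.indicator_of_mem (by exact ⟨hxr, trivial⟩), polar_pow_mul_conj_pow, hn,
        Complex.real_smul]
      push_cast
      ring
    · rw [Set.indicator_of_notMem (by rw [mem_ball_zero_iff, hn]; exact hxr),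
        Set.indicator_of_notMem (by rintro ⟨h, -⟩; exact hxr h), smul_zero]
  have h3 : (Set.Ioi (0 : ℝ) ×ˢ Set.Ioo (-Real.pi) Real.pi) ∩ (Set.Iio r ×ˢ (Set.univ : Set ℝ)) =
      Set.Ioo 0 r ×ˢ Set.Ioo (-Real.pi) Real.pi := by
    rw [Set.prod_inter_prod, Set.inter_univ]
    rfl
  have h5 : ∫ ρ in Set.Ioo 0 r, ((ρ ^ (p + q + 1) * (1 - ρ ^ 2) ^ i : ℝ) : ℂ) =
      ((∫ ρ in (0 : ℝ)..r, ρ ^ (p + q + 1) * (1 - ρ ^ 2) ^ i : ℝ) : ℂ) := by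
    rw [intervalIntegral.integral_of_le hr.le, integral_Ioc_eq_integral_Ioo]
    exact integral_ofReal
  rw [h2, setIntegral_indicator (measurableSet_Iio.prod MeasurableSet.univ), polarCoord_target, h3,
    Measure.volume_eq_prod, setIntegral_prod_mul
      (fun ρ : ℝ => ((ρ ^ (p + q + 1) * (1 - ρ ^ 2) ^ i : ℝ) : ℂ))
      (fun t : ℝ => ((Circle.exp t ^ ((p : ℤ) - q) : Circle) : ℂ)), h5,
    ← integral_Ioc_eq_integral_Ioo, ← intervalIntegral.integral_of_le (by linarith [Real.pi_pos])]
  have h4 := integral_exp_zpow (-Real.pi) ((p : ℤ) - q)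
  rw [show -Real.pi + 2 * Real.pi = Real.pi by ring] at h4
  rw [h4]
  split_ifs with e1 e2 e2
  · subst e2
    rw [radialIntegral, two_mul p, mul_comm]
  · omega
  · omega
  · simp

theorem continuous_radialIntegrand (i p : ℕ) :
    Continuous fun ρ : ℝ => ρ ^ (2 * p + 1) * (1 - ρ ^ 2) ^ i := by fun_prop

/-- A Beta integral, computed from `(1-ρ²)^(i+1) = (1-ρ²)^i - ρ²(1-ρ²)^i`, where the factor `ρ²`
raises `p` by one. -/
theorem radialIntegral_one (i p : ℕ) :
    radialIntegral i p 1 = (p ! * i ! : ℝ) / (2 * (p + i + 1)!) := by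
  induction i generalizing p with
  | zero =>
    simp only [radialIntegral, pow_zero, mul_one, integral_pow]
    rw [add_zero, Nat.factorial_succ]
    have := Nat.factorial_ne_zero p
    push_cast
    field_simp
    simp
    ring
  | succ i ih =>
    have h : radialIntegral (i + 1) p 1 = radialIntegral i p 1 - radialIntegral i (p + 1) 1 := by
      rw [radialIntegral, radialIntegral, radialIntegral, ← intervalIntegral.integral_sub
        ((continuous_radialIntegrand i p).intervalIntegrable _ _)
        ((continuous_radialIntegrand i (p + 1)).intervalIntegrable _ _)]
      refine intervalIntegral.integral_congr fun ρ _ => ?_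
      ring
    rw [h, ih, ih, show p + 1 + i + 1 = (p + i + 1) + 1 by ring,
      show p + (i + 1) + 1 = (p + i + 1) + 1 by ring, Nat.factorial_succ (p + i + 1),
      Nat.factorial_succ i, Nat.factorial_succ p]
    have := Nat.factorial_ne_zero (p + i + 1)
    push_cast
    field_simp
    ring

theorem tendsto_radialIntegral (i p : ℕ) :
    Filter.Tendsto (radialIntegral i p) (𝓝[<] 1) (𝓝 (radialIntegral i p 1)) :=
  ((intervalIntegral.continuous_primitive
    (fun _ _ => (continuous_radialIntegrand i p).intervalIntegrable _ _) 0).tendsto 1).mono_left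
    nhdsWithin_le_nhds

theorem abs_radialIntegral_le (i p : ℕ) {r : ℝ} (hr0 : 0 < r) (hr1 : r < 1) :
    |radialIntegral i p r| ≤ 1 := by
  have h := intervalIntegral.norm_integral_le_of_norm_le_const (a := 0) (b := r) (C := 1)
    (f := fun ρ : ℝ => ρ ^ (2 * p + 1) * (1 - ρ ^ 2) ^ i) (fun ρ hρ => by
      rw [Set.uIoc_of_le hr0.le] at hρ
      have h0 : 0 ≤ ρ := hρ.1.le
      have h1 : ρ ≤ 1 := hρ.2.trans hr1.le
      have h2 : 0 ≤ 1 - ρ ^ 2 := by nlinarith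
      rw [Real.norm_of_nonneg (by positivity)]
      exact mul_le_one₀ (pow_le_one₀ h0 h1) (by positivity) (pow_le_one₀ h2 (by nlinarith)))
  rw [one_mul, sub_zero, abs_of_pos hr0] at h
  exact h.trans hr1.le

/-! ### The weighted Dirichlet integrals as double series -/

/-- This separates the variables: polynomial growth of `μ̂(b-a)` is absorbed by the decay of `f̂(a)`
and `f̂(b)` individually. -/
theorem one_add_abs_sub_le (a b : ℕ) :
    1 + |(((b : ℤ) - a : ℤ) : ℝ)| ≤ (1 + a) * (1 + b) := by
  have ha : (0 : ℝ) ≤ a := Nat.cast_nonneg _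
  have hb : (0 : ℝ) ≤ b := Nat.cast_nonneg _
  have h : |(((b : ℤ) - a : ℤ) : ℝ)| ≤ a + b := by
    push_cast
    rw [abs_le]
    constructor <;> linarith
  nlinarith [mul_nonneg ha hb]

theorem summable_pairing {g : ℕ → ℂ} (hg : RapidDecay g) {c : ℤ → ℂ} {N : ℕ} {C : ℝ}
    (hc : ∀ k, ‖c k‖ ≤ C * (1 + |(k : ℝ)|) ^ N) :
    Summable fun p : ℕ × ℕ => ‖g p.1 * conj (g p.2) * c ((p.2 : ℤ) - p.1)‖ := by
  have hC : 0 ≤ C := by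
    have := (norm_nonneg _).trans (hc 0)
    simpa using this
  have h := ((hg N).mul_of_nonneg (hg N) (fun _ => by positivity) fun _ => by positivity).mul_left C
  refine Summable.of_nonneg_of_le (fun _ => norm_nonneg _) (fun p => ?_) h
  rw [norm_mul, norm_mul, RCLike.norm_conj]
  have h1 := one_add_abs_sub_le p.1 p.2
  calc ‖g p.1‖ * ‖g p.2‖ * ‖c ((p.2 : ℤ) - p.1)‖
      ≤ ‖g p.1‖ * ‖g p.2‖ * (C * ((1 + p.1) * (1 + p.2)) ^ N) := by
        gcongr
        exact (hc _).trans (by gcongr)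
    _ = _ := by rw [mul_pow]; ring

/-- The term of index `(a, b)` of the double series of `D_{μ,i}(f)`. -/
def pairingTerm (c : ℤ → ℂ) (i : ℕ) (f : AnalyticTest) (p : ℕ × ℕ) : ℂ :=
  (f : TestFun).coeff p.1 * conj ((f : TestFun).coeff p.2) * c ((p.2 : ℤ) - p.1) *
    (Nat.choose (min p.1 p.2) i : ℂ)

theorem tendsto_dirichletApprox_zero (μ : Distribution) (f : AnalyticTest) :
    Filter.Tendsto (dirichletApprox μ 0 f) (𝓝[<] 1)
      (𝓝 (∑' p : ℕ × ℕ, pairingTerm μ.coeff 0 f p)) := by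
  obtain ⟨N, C, hc⟩ := μ.growth
  have hg := f.rapidDecay
  have hpi : (Real.pi : ℂ) ≠ 0 := by exact_mod_cast Real.pi_ne_zero
  have hev : ∀ᶠ r : ℝ in 𝓝[<] 1, r ∈ Set.Ioo (0 : ℝ) 1 := Ioo_mem_nhdsLT (zero_lt_one' ℝ)
  have key : ∀ᶠ r : ℝ in 𝓝[<] 1, ∑' p : ℕ × ℕ, (f : TestFun).coeff p.1 *
      conj ((f : TestFun).coeff p.2) * μ.coeff ((p.2 : ℤ) - p.1) * (r : ℂ) ^ (2 * max p.1 p.2) =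
      dirichletApprox μ 0 f r := by
    filter_upwards [hev] with r hr
    have hr0 : 0 < r := hr.1
    have h := hasSum_integral_normSq_mul_poisson
      (volume.restrict (Set.Ioc (0 : ℝ) (2 * Real.pi)))
      (ζ := fun t => (r : ℂ) * (Circle.exp t : ℂ))
      (Continuous.measurable (by fun_prop)) (w := fun _ => 1) measurable_const hr0 hr.2
      (Filter.Eventually.of_forall fun t => by
        simp [abs_of_pos hr0]) hg hc
      (M := fun p => 2 * Real.pi * (r : ℂ) ^ (2 * p)) (integral_circle_moment r)
    have h2 := h.mul_left (2 * Real.pi : ℂ)⁻¹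
    simp only [dirichletApprox, f.extend_eq_powerSum]
    rw [intervalIntegral.integral_of_le (by positivity)]
    simp only [Complex.ofReal_one, mul_one] at h2
    rw [← h2.tsum_eq]
    refine tsum_congr fun p => ?_
    field_simp
  refine Filter.Tendsto.congr' key ?_
  -- The factors `r^(2 max(a,b))` have modulus at most `1` and tend to `1`, so the series without
  -- them is a dominating one.
  refine tendsto_tsum_of_dominated_convergence (summable_pairing hg hc) (fun p => ?_) ?_
  · have h1 : Filter.Tendsto (fun r : ℝ => (r : ℂ) ^ (2 * max p.1 p.2)) (𝓝[<] 1)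
        (𝓝 (((1 : ℝ) : ℂ) ^ (2 * max p.1 p.2))) := by
      apply Filter.Tendsto.mono_left _ nhdsWithin_le_nhds
      apply Continuous.tendsto
      fun_prop
    simpa [pairingTerm] using h1.const_mul ((f : TestFun).coeff p.1 *
      conj ((f : TestFun).coeff p.2) * μ.coeff ((p.2 : ℤ) - p.1))
  · filter_upwards [hev] with r hr p
    refine norm_mul_pow_le ?_ _ _
    rw [Complex.norm_real, Real.norm_of_nonneg hr.1.le]
    exact hr.2.le

/-- This explains the normalization of `D_{μ,i}`. For `a ≤ b`, the radial integral `b! i! / (2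
(b+i+1)!)` cancels the falling factorial of the larger index, and the prefactor turns the other into
a binomial. Hence the weight depends on the minimum only. -/
theorem moment_coeff_eq_choose (i a b : ℕ) :
    ((a + (i + 1)).descFactorial (i + 1) : ℂ) * ((b + (i + 1)).descFactorial (i + 1) : ℂ) *
      ((Real.pi * (i + 1)! * i ! : ℂ)⁻¹ *
        (2 * Real.pi * (radialIntegral i (max a b) 1 : ℂ))) =
      (Nat.choose (min (a + (i + 1)) (b + (i + 1))) (i + 1) : ℂ) := by
  wlog hab : a ≤ b generalizing a b with H
  · rw [max_comm, min_comm, ← H b a (by omega)]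
    ring
  · have hpi : (Real.pi : ℂ) ≠ 0 := by exact_mod_cast Real.pi_ne_zero
    rw [max_eq_right hab, min_eq_left (by omega), radialIntegral_one,
      Nat.descFactorial_eq_factorial_mul_choose (a + (i + 1))]
    have h1 := Nat.factorial_mul_descFactorial (show i + 1 ≤ b + (i + 1) by omega)
    rw [Nat.add_sub_cancel] at h1
    have h2 : (b ! : ℂ) * ((b + (i + 1)).descFactorial (i + 1) : ℂ) = ((b + i + 1)! : ℂ) := by
      exact_mod_cast h1
    have n1 : ((b + i + 1)! : ℂ) ≠ 0 := by exact_mod_cast Nat.factorial_ne_zero _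
    have n2 : (i ! : ℂ) ≠ 0 := by exact_mod_cast Nat.factorial_ne_zero _
    have n3 : ((i + 1)! : ℂ) ≠ 0 := by exact_mod_cast Nat.factorial_ne_zero _
    push_cast
    field_simp
    linear_combination ((a + (i + 1)).choose (i + 1) : ℂ) * h2

theorem tendsto_dirichletApprox_succ (μ : Distribution) (i : ℕ) (f : AnalyticTest) :
    Filter.Tendsto (dirichletApprox μ (i + 1) f) (𝓝[<] 1)
      (𝓝 (∑' p : ℕ × ℕ, pairingTerm μ.coeff (i + 1) f p)) := by
  obtain ⟨N, C, hc⟩ := μ.growth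
  have hg := f.rapidDecay.shift (i + 1)
  set g : ℕ → ℂ := fun n => ((n + (i + 1)).descFactorial (i + 1) : ℂ) *
    (f : TestFun).coeff ((n + (i + 1) : ℕ) : ℤ) with hgdef
  set K : ℂ := (Real.pi * (i + 1)! * i ! : ℂ)⁻¹
  have hev : ∀ᶠ r : ℝ in 𝓝[<] 1, r ∈ Set.Ioo (0 : ℝ) 1 := Ioo_mem_nhdsLT (zero_lt_one' ℝ)
  have key : ∀ᶠ r : ℝ in 𝓝[<] 1, ∑' p : ℕ × ℕ, g p.1 * conj (g p.2) *
      μ.coeff ((p.2 : ℤ) - p.1) * (K * (2 * Real.pi * (radialIntegral i (max p.1 p.2) r : ℂ))) =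
      dirichletApprox μ (i + 1) f r := by
    filter_upwards [hev] with r hr
    have hr0 : 0 < r := hr.1
    have hball : ∀ᵐ z ∂volume.restrict (Metric.ball (0 : ℂ) r), ‖z‖ < r := by
      filter_upwards [ae_restrict_mem measurableSet_ball] with z hz
      exact mem_ball_zero_iff.1 hz
    have : IsFiniteMeasure (volume.restrict (Metric.ball (0 : ℂ) r)) :=
      ⟨by rw [Measure.restrict_apply_univ]; exact measure_ball_lt_top⟩
    have h := hasSum_integral_normSq_mul_poisson (volume.restrict (Metric.ball (0 : ℂ) r))
      (ζ := fun z => z) measurable_id (w := fun z => (1 - ‖z‖ ^ 2) ^ i)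
      (Continuous.measurable (by fun_prop)) hr0 hr.2
      (by
        filter_upwards [hball] with z hz
        have h0 := norm_nonneg z
        have h1 : 0 ≤ 1 - ‖z‖ ^ 2 := by nlinarith [hr.2]
        refine ⟨hz.le, ?_⟩
        rw [abs_of_nonneg (by positivity)]
        exact pow_le_one₀ h1 (by nlinarith)) hg hc
      (M := fun p => 2 * Real.pi * (radialIntegral i p r : ℂ)) (integral_ball_moment i hr0)
    have h2 := h.mul_left K
    have h3 : dirichletApprox μ (i + 1) f r = K * ∫ z in Metric.ball (0 : ℂ) r,
        ((‖powerSum g z‖ ^ 2 : ℝ) : ℂ) * poisson μ.coeff z * (((1 - ‖z‖ ^ 2) ^ i : ℝ) : ℂ) := by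
      simp only [dirichletApprox, f.extend_eq_powerSum]
      congr 1
      refine integral_congr_ae ?_
      filter_upwards [hball] with z hz
      rw [f.rapidDecay.iteratedDeriv_powerSum (i + 1) (hz.trans hr.2)]
    rw [h3, ← h2.tsum_eq]
    refine tsum_congr fun p => ?_
    ring
  -- Differentiating `i+1` times lowers both indices by `i+1`. Terms with `min(a,b) < i+1` vanish
  -- through the binomial, so reindexing loses nothing, and `b-a` is unchanged.
  have hlim : ∑' p : ℕ × ℕ, pairingTerm μ.coeff (i + 1) f p =
      ∑' p : ℕ × ℕ, g p.1 * conj (g p.2) * μ.coeff ((p.2 : ℤ) - p.1) *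
        (K * (2 * Real.pi * (radialIntegral i (max p.1 p.2) 1 : ℂ))) := by
    have hinj : Function.Injective fun p : ℕ × ℕ => (p.1 + (i + 1), p.2 + (i + 1)) :=
      fun p q h => by
        simp only [Prod.mk.injEq] at h
        exact Prod.ext (by omega) (by omega)
    rw [← hinj.tsum_eq]
    · refine tsum_congr fun p => ?_
      simp only [pairingTerm, hgdef, map_mul, map_natCast]
      rw [← moment_coeff_eq_choose i p.1 p.2,
        show (((p.2 + (i + 1) : ℕ) : ℤ) - ((p.1 + (i + 1) : ℕ) : ℤ)) = (p.2 : ℤ) - p.1 by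
          push_cast; ring]
      ring
    · intro p hp
      have h : i + 1 ≤ min p.1 p.2 := by
        by_contra! hlt
        exact hp (by rw [pairingTerm, Nat.choose_eq_zero_of_lt hlt]; simp)
      exact ⟨(p.1 - (i + 1), p.2 - (i + 1)), Prod.ext (by dsimp only; omega)
        (by dsimp only; omega)⟩
  rw [hlim]
  refine Filter.Tendsto.congr' key ?_
  refine tendsto_tsum_of_dominated_convergence
    ((summable_pairing hg hc).mul_right ‖K * (2 * Real.pi)‖) (fun p => ?_) ?_
  · have h1 := (Complex.continuous_ofReal.tendsto _).comp (tendsto_radialIntegral i (max p.1 p.2))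
    exact ((h1.const_mul _).const_mul _).const_mul _
  · filter_upwards [hev] with r hr p
    rw [norm_mul, ← mul_assoc K, norm_mul (K * _), Complex.norm_real, Real.norm_eq_abs]
    refine mul_le_mul_of_nonneg_left ?_ (norm_nonneg _)
    exact mul_le_of_le_one_right (norm_nonneg _) (abs_radialIntegral_le i _ hr.1 hr.2)

/-- `D_{μ,i}(f) = ∑_{a,b} f̂(a) conj (f̂(b)) C(min(a,b), i) μ̂(b - a)`. -/
theorem tendsto_dirichletApprox (μ : Distribution) (i : ℕ) (f : AnalyticTest) :
    Filter.Tendsto (dirichletApprox μ i f) (𝓝[<] 1)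
      (𝓝 (∑' p : ℕ × ℕ, pairingTerm μ.coeff i f p)) := by
  rcases i with _ | i
  · exact tendsto_dirichletApprox_zero μ f
  · exact tendsto_dirichletApprox_succ μ i f

theorem dirichletIntegral_eq_tsum (μ : Distribution) (i : ℕ) (f : AnalyticTest) :
    dirichletIntegral μ i f = ∑' p : ℕ × ℕ, pairingTerm μ.coeff i f p :=
  (tendsto_dirichletApprox μ i f).limUnder_eq

theorem summable_pairingTerm (μ : Distribution) (i : ℕ) (f : AnalyticTest) :
    Summable (pairingTerm μ.coeff i f) := by
  obtain ⟨N, C, hc⟩ := μ.growth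
  have hC : 0 ≤ C := by
    have := (norm_nonneg _).trans (hc 0)
    simpa using this
  have hF := f.rapidDecay
  have h := ((hF (N + i)).mul_of_nonneg (hF (N + i)) (fun _ => by positivity)
    fun _ => by positivity).mul_left C
  refine Summable.of_norm_bounded h fun p => ?_
  have ha : (0 : ℝ) ≤ p.1 := Nat.cast_nonneg _
  have hb : (0 : ℝ) ≤ p.2 := Nat.cast_nonneg _
  have h1 := one_add_abs_sub_le p.1 p.2
  have h2 : (Nat.choose (min p.1 p.2) i : ℝ) ≤ ((1 + p.1) * (1 + p.2)) ^ i := by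
    calc (Nat.choose (min p.1 p.2) i : ℝ) ≤ ((min p.1 p.2 : ℕ) : ℝ) ^ i := by
          exact_mod_cast Nat.choose_le_pow _ _
      _ ≤ (p.1 : ℝ) ^ i := by gcongr; exact min_le_left _ _
      _ ≤ _ := by gcongr; nlinarith
  rw [pairingTerm, norm_mul, norm_mul, norm_mul, RCLike.norm_conj, Complex.norm_natCast]
  calc _ ≤ ‖(f : TestFun).coeff p.1‖ * ‖(f : TestFun).coeff p.2‖ *
        (C * ((1 + p.1) * (1 + p.2)) ^ N) * ((1 + p.1) * (1 + p.2)) ^ i := by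
        gcongr
        exact (hc _).trans (by gcongr)
    _ = _ := by simp only [mul_pow, pow_add]; ring

/-! ### The tuple of the shift -/

/-- The tuple `(μ₀, …, μ_{2m-1})` of the shift on `D_λ^m`. -/
def localTuple (m : ℕ) (lam : Circle) (i : Fin (2 * m)) : Distribution :=
  if (i : ℕ) = 0 then lebesgue else localDistribution m lam i

theorem localTuple_of_ne_zero {m : ℕ} (lam : Circle) {i : Fin (2 * m)} (hi : 1 ≤ (i : ℕ)) :
    localTuple m lam i = localDistribution m lam i := if_neg (by omega)

/-- For `i = 0` this is orthogonality of `z^k` to `1`. For `i ≥ 1` the multiplier depends on `|k|`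
only and is real, so both signs of `k` follow from `λ̄ = λ⁻¹`. -/
theorem isTupleOf_localTuple (m : ℕ) (hm : 1 ≤ m) (lam : Circle) :
    IsTupleOf (shift m lam) (LocalDirichlet.one m lam hm) (localTuple m lam) := by
  rintro ⟨i, hi⟩ k
  rcases i with _ | i
  · have h0 : localTuple m lam ⟨0, hi⟩ = lebesgue := if_pos rfl
    have h1 : defect (shift m lam) 0 (LocalDirichlet.one m lam hm) =
      LocalDirichlet.one m lam hm := rfl
    rw [h0, coeff_lebesgue, coeff_lebesgue, h1, LocalDirichlet.inner_shift_pow_one]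
    by_cases hk : k = 0 <;> simp [hk]
  · rw [localTuple_of_ne_zero lam (show 1 ≤ i + 1 by omega)]
    dsimp only
    rw [LocalDirichlet.inner_defect_succ_one m hm lam i k hi,
      coeff_localDistribution m lam _ hi (by omega), coeff_localDistribution m lam _ hi (by omega),
      Int.natAbs_neg, Int.natAbs_natCast, neg_neg, show i + 1 - 1 = i by omega,
      show 2 * m - 1 - (i + 1) = 2 * (m - 1) - i by omega, zpow_neg, zpow_natCast]
    constructor
    · rw [Circle.coe_inv_eq_conj, Circle.coe_pow, map_pow, mul_comm]
    · rw [map_mul, Circle.coe_pow, map_pow, map_natCast, mul_comm]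

theorem IsTupleOf.eq {H : Type*} [NormedAddCommGroup H] [InnerProductSpace ℂ H] [CompleteSpace H]
    {T : H →L[ℂ] H} {e : H} {n : ℕ} {μ ν : Fin n → Distribution} (hμ : IsTupleOf T e μ)
    (hν : IsTupleOf T e ν) : μ = ν := by
  funext i
  apply Distribution.ext_coeff
  intro k
  obtain ⟨k, rfl | rfl⟩ := k.eq_nat_or_neg
  · rw [(hμ i k).1, (hν i k).1]
  · exact (starRingEnd ℂ).injective ((hμ i k).2.trans (hν i k).2.symm)

/-- The Gram matrix of the orbit of `e` in terms of the tuple of an `n`-isometry. -/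
theorem IsTupleOf.inner_pow {H : Type*} [NormedAddCommGroup H] [InnerProductSpace ℂ H]
    [CompleteSpace H] {T : H →L[ℂ] H} {e : H} {n : ℕ} (hT : defect T n = 0)
    {μ : Fin n → Distribution} (hμ : IsTupleOf T e μ) (a b : ℕ) :
    inner ℂ ((T ^ b) e) ((T ^ a) e) =
      ∑ i : Fin n, (Nat.choose (min a b) i : ℂ) * (μ i).coeff ((b : ℤ) - a) := by
  have key : ∀ a k : ℕ, inner ℂ ((T ^ (a + k)) e) ((T ^ a) e) =
      ∑ i : Fin n, (Nat.choose a i : ℂ) * (μ i).coeff k := by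
    intro a k
    have h := inner_pow_eq_sum_defect_of_isometry T hT e ((T ^ k) e) a
    rw [Finset.sum_range] at h
    rw [pow_add]
    refine h.trans (Finset.sum_congr rfl fun i _ => ?_)
    rw [(hμ i k).1]
  rcases le_total a b with h | h
  · obtain ⟨k, rfl⟩ := Nat.exists_eq_add_of_le h
    rw [key, min_eq_left h]
    refine Finset.sum_congr rfl fun i _ => ?_
    push_cast
    rw [add_sub_cancel_left]
  -- For `a ≥ b` the inner product is the conjugate of the case already treated, and the relation
  -- between `μ̂(-k)` and `μ̂(k)` absorbs the conjugation.
  · obtain ⟨k, rfl⟩ := Nat.exists_eq_add_of_le h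
    rw [← inner_conj_symm, key, min_eq_right h, map_sum]
    refine Finset.sum_congr rfl fun i _ => ?_
    rw [map_mul, map_natCast, (hμ i k).1, ← (hμ i k).2, Complex.conj_conj]
    congr 2
    push_cast
    ring

/-! ### The analytic test functions inside the local Dirichlet space -/

/-- Rapid decay of `f̂` beats the polynomial growth of the orbit, so smooth boundary functions
belong to the space. -/
theorem summable_smul_shift_pow (m : ℕ) (hm : 1 ≤ m) (lam : Circle) (f : AnalyticTest) :
    Summable fun n : ℕ =>
      (f : TestFun).coeff n • (shift m lam ^ n) (LocalDirichlet.one m lam hm) := by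
  refine Summable.of_norm_bounded (f.rapidDecay (2 * (m - 1) + 1)) fun n => ?_
  rw [norm_smul]
  exact mul_le_mul_of_nonneg_left (LocalDirichlet.norm_shift_pow_one_le m hm lam n) (norm_nonneg _)

/-- The inclusion of the analytic test functions into `D_λ^m`. -/
def modelMap (m : ℕ) (hm : 1 ≤ m) (lam : Circle) : AnalyticTest →ₗ[ℂ] LocalDirichlet m lam where
  toFun f := ∑' n : ℕ, (f : TestFun).coeff n • (shift m lam ^ n) (LocalDirichlet.one m lam hm)
  map_add' f g := by
    rw [← (summable_smul_shift_pow m hm lam f).tsum_add (summable_smul_shift_pow m hm lam g)]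
    refine tsum_congr fun n => ?_
    rw [← add_smul, ← TestFun.coeff_add]
    rfl
  map_smul' c f := by
    rw [RingHom.id_apply, ← (summable_smul_shift_pow m hm lam f).tsum_const_smul]
    refine tsum_congr fun n => ?_
    rw [smul_smul, ← TestFun.coeff_smul]
    rfl

theorem hasSum_modelMap (m : ℕ) (hm : 1 ≤ m) (lam : Circle) (f : AnalyticTest) :
    HasSum (fun n : ℕ => (f : TestFun).coeff n • (shift m lam ^ n) (LocalDirichlet.one m lam hm))
      (modelMap m hm lam f) := (summable_smul_shift_pow m hm lam f).hasSum

theorem LocalDirichlet.exists_evalL (z : ℂ) (hz : ‖z‖ < 1) (m : ℕ) (lam : Circle) :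
    ∃ L : LocalDirichlet m lam →L[ℂ] ℂ, ∀ F, L F = LocalDirichlet.eval F z :=
  ⟨{ toFun := fun F => LocalDirichlet.eval F z
     map_add' := fun F G => LocalDirichlet.eval_add F G z hz
     map_smul' := fun c F => LocalDirichlet.eval_smul c F z hz
     cont := LocalDirichlet.continuous_eval z hz }, fun _ => rfl⟩

theorem eval_modelMap (m : ℕ) (hm : 1 ≤ m) (lam : Circle) (f : AnalyticTest) (z : ℂ)
    (hz : ‖z‖ < 1) : LocalDirichlet.eval (modelMap m hm lam f) z = f.extend z := by
  obtain ⟨L, hL⟩ := LocalDirichlet.exists_evalL z hz m lam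
  have h := L.hasSum (hasSum_modelMap m hm lam f)
  rw [hL] at h
  rw [f.extend_eq_powerSum, powerSum, ← h.tsum_eq]
  refine tsum_congr fun n => ?_
  rw [map_smul, hL, LocalDirichlet.eval_shift_pow_one m hm lam n z hz, smul_eq_mul]

theorem AnalyticTest.coeff_mulZ_zero (f : AnalyticTest) : (f.mulZ : TestFun).coeff 0 = 0 :=
  (TestFun.coeff_mulZ _ _).trans (f.2 _ (by norm_num))

/-- Multiplication by `z` shifts the coefficients; the new term of index `0` is `f̂(-1) = 0` because
`f` is analytic. -/
theorem modelMap_mulZ (m : ℕ) (hm : 1 ≤ m) (lam : Circle) (f : AnalyticTest) :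
    modelMap m hm lam f.mulZ = shift m lam (modelMap m hm lam f) := by
  refine ((hasSum_modelMap m hm lam f.mulZ).unique ?_)
  have h := (shift m lam).hasSum (hasSum_modelMap m hm lam f)
  rw [← hasSum_nat_add_iff' 1]
  simp only [Finset.range_one, Finset.sum_singleton, Nat.cast_zero, f.coeff_mulZ_zero, zero_smul,
    sub_zero]
  refine (congrArg (fun G => HasSum G _) (funext fun n => ?_)).mpr h
  rw [map_smul, pow_succ']
  have h1 : (f.mulZ : TestFun).coeff ((n + 1 : ℕ) : ℤ) = (f : TestFun).coeff n :=
    (TestFun.coeff_mulZ _ _).trans (by push_cast; rw [add_sub_cancel_right])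
  rw [h1]
  rfl

/-- The analytic test function `zᵃ`. -/
def AnalyticTest.pow (a : ℕ) : AnalyticTest :=
  ⟨monomial a, fun k hk => by rw [coeff_monomial, if_neg (by omega)]⟩

theorem modelMap_pow (m : ℕ) (hm : 1 ≤ m) (lam : Circle) (a : ℕ) :
    modelMap m hm lam (AnalyticTest.pow a) = (shift m lam ^ a) (LocalDirichlet.one m lam hm) := by
  refine (tsum_eq_single a fun n hn => ?_).trans ?_
  · change (monomial a).coeff n • _ = _
    rw [coeff_monomial, if_neg (by exact_mod_cast hn), zero_smul]
  · change (monomial a).coeff a • _ = _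
    rw [coeff_monomial, if_pos rfl, one_smul]

theorem modelMap_one (m : ℕ) (hm : 1 ≤ m) (lam : Circle) :
    modelMap m hm lam AnalyticTest.one = LocalDirichlet.one m lam hm :=
  modelMap_pow m hm lam 0

theorem denseRange_modelMap (m : ℕ) (hm : 1 ≤ m) (lam : Circle) :
    DenseRange (modelMap m hm lam) := by
  have h := Submodule.dense_iff_topologicalClosure_eq_top.2
    (LocalDirichlet.isCyclicVector_one m hm lam)
  refine h.mono ?_
  have h1 : Submodule.span ℂ (Set.range fun k : ℕ =>
      (shift m lam ^ k) (LocalDirichlet.one m lam hm)) ≤ LinearMap.range (modelMap m hm lam) := by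
    rw [Submodule.span_le]
    rintro _ ⟨k, rfl⟩
    exact ⟨AnalyticTest.pow k, modelMap_pow m hm lam k⟩
  exact h1

/-- The norm of the sum of a series as a double series of inner products. -/
theorem norm_sq_eq_tsum_of_hasSum {H : Type*} [NormedAddCommGroup H] [InnerProductSpace ℂ H]
    {c : ℕ → ℂ} {e : ℕ → H} {x : H} (hx : HasSum (fun n => c n • e n) x)
    (hS : Summable fun p : ℕ × ℕ => c p.1 * (conj (c p.2) * inner ℂ (e p.2) (e p.1))) :
    ((‖x‖ ^ 2 : ℝ) : ℂ) = ∑' p : ℕ × ℕ, c p.1 * (conj (c p.2) * inner ℂ (e p.2) (e p.1)) := by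
  have hL : ∀ y : H, HasSum (fun n => conj (c n) * inner ℂ (e n) y) (inner ℂ x y) := by
    intro y
    -- The series sits in the conjugate-linear slot, so it is summed in the linear one and then
    -- conjugated.
    have h2 := ((innerSL ℂ y).hasSum hx).map (starRingEnd ℂ) Complex.continuous_conj
    simpa only [innerSL_apply_apply, Function.comp_def, inner_smul_left, inner_conj_symm] using h2
  have hR : HasSum (fun n => c n * inner ℂ x (e n)) (inner ℂ x x) := by
    have h2 := (innerSL ℂ x).hasSum hx
    simpa only [innerSL_apply_apply, Function.comp_def, inner_smul_right] using h2
  rw [hS.tsum_prod]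
  simp only [tsum_mul_left, (hL _).tsum_eq, hR.tsum_eq]
  rw [inner_self_eq_norm_sq_to_K]
  push_cast
  rfl

/-- Both sides are the same double series: summed over `i`, the terms of `D_{μ_i,i}(f)` at `(a,b)`
give `f̂(a) conj(f̂(b)) ⟨T^a 1, T^b 1⟩` by the Gram formula for `2m`-isometries. Absolute
convergence permits interchanging the sums. -/
theorem norm_sq_modelMap (m : ℕ) (hm : 1 ≤ m) (lam : Circle) (f : AnalyticTest) :
    ((‖modelMap m hm lam f‖ ^ 2 : ℝ) : ℂ) = tupleForm (localTuple m lam) f := by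
  set J := modelMap m hm lam f
  set e : ℕ → LocalDirichlet m lam := fun n => (shift m lam ^ n) (LocalDirichlet.one m lam hm)
  set c : ℕ → ℂ := fun n => (f : TestFun).coeff n
  have hJ : HasSum (fun n => c n • e n) J := hasSum_modelMap m hm lam f
  have hterm : ∀ p : ℕ × ℕ, ∑ i : Fin (2 * m), pairingTerm (localTuple m lam i).coeff i f p =
      c p.1 * (conj (c p.2) * inner ℂ (e p.2) (e p.1)) := by
    intro p
    rw [IsTupleOf.inner_pow (LocalDirichlet.defect_shift_eq_zero m hm lam)
      (isTupleOf_localTuple m hm lam) p.1 p.2, Finset.mul_sum, Finset.mul_sum]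
    refine Finset.sum_congr rfl fun i _ => ?_
    simp only [pairingTerm, c]
    ring
  have hs : ∀ i ∈ (Finset.univ : Finset (Fin (2 * m))),
      Summable (pairingTerm (localTuple m lam i).coeff i f) :=
    fun i _ => summable_pairingTerm _ _ f
  have h1 : tupleForm (localTuple m lam) f =
      ∑' p : ℕ × ℕ, c p.1 * (conj (c p.2) * inner ℂ (e p.2) (e p.1)) := by
    simp only [tupleForm, dirichletIntegral_eq_tsum]
    rw [← Summable.tsum_finsetSum hs]
    exact tsum_congr hterm
  have hS : Summable fun p : ℕ × ℕ => c p.1 * (conj (c p.2) * inner ℂ (e p.2) (e p.1)) := by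
    simpa only [hterm] using summable_sum hs
  rw [h1]
  exact norm_sq_eq_tsum_of_hasSum hJ hS

theorem isModelMap_modelMap (m : ℕ) (hm : 1 ≤ m) (lam : Circle) :
    IsModelMap (localTuple m lam) (shift m lam) (LocalDirichlet.one m lam hm)
      (modelMap m hm lam) where
  norm_sq := norm_sq_modelMap m hm lam
  dense := denseRange_modelMap m hm lam
  map_mulZ := modelMap_mulZ m hm lam
  map_one := modelMap_one m hm lam

open scoped ComplexOrder in
theorem isNormalizedAllowable_localTuple (m : ℕ) (hm : 1 ≤ m) (lam : Circle) :
    IsNormalizedAllowable (localTuple m lam) where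
  tendsto i f := by
    rw [dirichletIntegral_eq_tsum]
    exact tendsto_dirichletApprox _ _ f
  form_one := by
    rw [← norm_sq_modelMap m hm lam, modelMap_one, LocalDirichlet.norm_one]
    simp
  bounded := by
    -- The form is the squared norm of the image of `f`, so `‖T‖²` bounds it; adding `1` makes the
    -- positivity of the constant immediate.
    refine ⟨‖shift m lam‖ ^ 2 + 1, by positivity, fun f => ?_⟩
    rw [← norm_sq_modelMap m hm lam, ← norm_sq_modelMap m hm lam, modelMap_mulZ]
    refine ⟨Complex.zero_le_real.2 (by positivity), ?_⟩
    rw [← Complex.ofReal_mul, Complex.real_le_real]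
    calc ‖shift m lam (modelMap m hm lam f)‖ ^ 2
        ≤ (‖shift m lam‖ * ‖modelMap m hm lam f‖) ^ 2 := by
          gcongr
          exact (shift m lam).le_opNorm _
      _ = ‖shift m lam‖ ^ 2 * ‖modelMap m hm lam f‖ ^ 2 := mul_pow _ _ _
      _ ≤ _ := by gcongr; linarith

end HigherDirichlet

end

theorem mainTheorem6 (m : ℕ) (hm : 1 ≤ m) (lam : Circle) :
    -- `M_z` on `D_λ^m` is an expansive strict `2m`-isometry with cyclic unit vector `1`
    HigherDirichlet.IsExpansive (HigherDirichlet.shift m lam) ∧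
    HigherDirichlet.IsStrictIsometry (HigherDirichlet.shift m lam) (2 * m) ∧
    ‖HigherDirichlet.LocalDirichlet.one m lam hm‖ = 1 ∧
    HigherDirichlet.IsCyclicVector (HigherDirichlet.shift m lam)
      (HigherDirichlet.LocalDirichlet.one m lam hm) ∧
    ∃ μ : Fin (2 * m) → HigherDirichlet.Distribution,
      -- `μ` is the tuple of `M_z`, and no other tuple is
      (∀ ν : Fin (2 * m) → HigherDirichlet.Distribution,
        HigherDirichlet.IsTupleOf (HigherDirichlet.shift m lam)
          (HigherDirichlet.LocalDirichlet.one m lam hm) ν ↔ ν = μ) ∧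
      -- it is a normalized allowable tuple
      HigherDirichlet.IsNormalizedAllowable μ ∧
      -- `D_λ^m` is the space `D_μ`, the inclusion of the analytic test functions being the map `J`
      (∃ J : HigherDirichlet.AnalyticTest →ₗ[ℂ] HigherDirichlet.LocalDirichlet m lam,
        HigherDirichlet.IsModelMap μ (HigherDirichlet.shift m lam)
          (HigherDirichlet.LocalDirichlet.one m lam hm) J ∧
        ∀ (f : HigherDirichlet.AnalyticTest) (z : ℂ), ‖z‖ < 1 →
          HigherDirichlet.LocalDirichlet.eval (J f) z = f.extend z) ∧
      -- the explicit form of the tuple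
      (∀ i : Fin (2 * m), (i : ℕ) = 0 → μ i = HigherDirichlet.lebesgue) ∧
      (∀ i : Fin (2 * m), 1 ≤ (i : ℕ) → (i : ℕ) ≤ 2 * m - 2 →
        μ i = ((Nat.choose (i - 1) (m - 1) : ℂ) / (Nat.factorial (2 * m - 1 - i) : ℂ)) •
          HigherDirichlet.prodAbsDeriv ((i : ℤ) + 1 - m) ((m : ℤ) - 1)
            (HigherDirichlet.dirac lam)) ∧
      (∀ i : Fin (2 * m), (i : ℕ) = 2 * m - 1 →
        μ i = (Nat.choose (2 * m - 2) (m - 1) : ℂ) • HigherDirichlet.dirac lam) ∧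
      -- vanishing and orders
      (∀ i : Fin (2 * m), 1 ≤ (i : ℕ) → (i : ℕ) ≤ m - 1 → μ i = 0) ∧
      (∀ i : Fin (2 * m), m ≤ (i : ℕ) → (μ i).HasOrder (2 * m - 1 - i)) := by
  refine ⟨HigherDirichlet.LocalDirichlet.isExpansive_shift m lam,
    HigherDirichlet.LocalDirichlet.isStrictIsometry_shift m hm lam,
    HigherDirichlet.LocalDirichlet.norm_one m hm lam,
    HigherDirichlet.LocalDirichlet.isCyclicVector_one m hm lam,
    HigherDirichlet.localTuple m lam, fun ν => ⟨fun h => ?_, fun h => ?_⟩,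
    HigherDirichlet.isNormalizedAllowable_localTuple m hm lam,
    ⟨HigherDirichlet.modelMap m hm lam, HigherDirichlet.isModelMap_modelMap m hm lam,
      HigherDirichlet.eval_modelMap m hm lam⟩,
    fun i hi => if_pos hi, fun i hi _ => HigherDirichlet.localTuple_of_ne_zero lam hi,
    fun i hi => ?_, fun i h0 hi => ?_, fun i hi => ?_⟩
  · exact h.eq (HigherDirichlet.isTupleOf_localTuple m hm lam)
  · rw [h]
    exact HigherDirichlet.isTupleOf_localTuple m hm lam
  · rw [HigherDirichlet.localTuple_of_ne_zero lam (by omega), hi]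
    exact HigherDirichlet.localDistribution_last m hm lam
  · rw [HigherDirichlet.localTuple_of_ne_zero lam h0]
    exact HigherDirichlet.localDistribution_eq_zero m lam i h0 hi
  · rw [HigherDirichlet.localTuple_of_ne_zero lam (by omega)]
    exact HigherDirichlet.hasOrder_localDistribution m lam i hm hi i.2
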